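/- There are constants $C>1$ and $R>0$, and for every $c>0$ a constant $K>0$, such that for all integers $m\ge 1$ and $1\le k\le n$ there is a randomized adaptive scheme with the following properties. The scheme accesses an unknown matrix $A=(A_1,\dots,A_m)\in\mathbb{R}^{n\times m}$ only through linear measurements $a^{\top}A_j$ of single columns. It works in rounds: in each round it chooses, for every column $j$, a sensing matrix $S_j\in\mathbb{R}^{t_j\times n}$ (with any number $t_j\ge 0$ of rows), depending only on its random seed and on the answers of the earlier rounds, and it receives $S_1A_1,\dots,S_mA_m$, at a cost of $\sum_j t_j$ measurements; at the end it outputs a matrix $A'\in\mathbb{R}^{n\times m}$. The output depends measurably on the seed and on $A$. For every $A\in\mathbb{R}^{n\times m}$: 1. with probability at least $1-n^{-c}$, $$\|A-A'\|_1\le C\cdot\min\bigl\{\|A-A^*\|_1 : A^*\in\mathbb{R}^{n\times m}\text{ has at most }km\text{ non-zero entries}\bigr\},$$ where $\|B\|_1=\sum_{i,j}|B_{ij}|$; 2. for every outcome of the randomness, $A'$ has at most $km$ non-zero entries, and the scheme performs at most $K\,k\,m\,\log(2n)\,\log(2m)$ linear measurements in at most $R\log(2m)$ adaptive rounds. (For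 $n,m\ge 2$ these bounds are $O(km\log n\log m)$ and $O(\log m)$.) -/

import Mathlib

open MeasureTheory

noncomputable section

/-- The entrywise `ℓ₁`-norm `‖A‖₁ = ∑ i j, |A i j|` of a matrix. -/
def matrixL1 {n m : ℕ} (A : Matrix (Fin n) (Fin m) ℝ) : ℝ :=
  ∑ j, ∑ i, |A i j|

/-- The number `‖A‖₀` of non-zero entries of a matrix, summed over its columns. -/
def matrixL0 {n m : ℕ} (A : Matrix (Fin n) (Fin m) ℝ) : ℕ :=
  ∑ j, hammingNorm (A.col j)

/-- A matrix is `s`-sparse if it has at most `s` non-zero entries. -/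
def IsSparseMatrix {n m : ℕ} (s : ℕ) (A : Matrix (Fin n) (Fin m) ℝ) : Prop :=
  matrixL0 A ≤ s

/-- The errors `‖A - B‖₁` of the `s`-sparse approximations `B` of `A`. -/
def sparseErrors {n m : ℕ} (s : ℕ) (A : Matrix (Fin n) (Fin m) ℝ) : Set ℝ :=
  {e | ∃ B : Matrix (Fin n) (Fin m) ℝ, IsSparseMatrix s B ∧ e = matrixL1 (A - B)}

/-- The optimum `min {‖A - B‖₁ : B is s-sparse}`; by `isLeast_sparseOpt` it is attained. -/
def sparseOpt {n m : ℕ} (s : ℕ) (A : Matrix (Fin n) (Fin m) ℝ) : ℝ :=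
  sInf (sparseErrors s A)

theorem isLeast_sparseOpt {n m : ℕ} (s : ℕ) (A : Matrix (Fin n) (Fin m) ℝ) :
    IsLeast (sparseErrors s A) (sparseOpt s A) := by
  classical
  let keep : Finset (Fin n × Fin m) → Matrix (Fin n) (Fin m) ℝ :=
    fun T => Matrix.of fun i j => if (i, j) ∈ T then A i j else 0
  let supp : Matrix (Fin n) (Fin m) ℝ → Finset (Fin n × Fin m) :=
    fun B => Finset.univ.filter fun p => B p.1 p.2 ≠ 0
  have hkeep : ∀ B, IsSparseMatrix s B → IsSparseMatrix s (keep (supp B)) := by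
    intro B hB
    refine le_trans (Finset.sum_le_sum fun j _ => ?_) hB
    refine Finset.card_le_card fun i hi => ?_
    simp only [Finset.mem_filter, Finset.mem_univ, true_and] at hi ⊢
    intro h0
    apply hi
    have h1 : B i j = 0 := h0
    simp [keep, supp, Matrix.col, h1]
  have herr : ∀ B, matrixL1 (A - keep (supp B)) ≤ matrixL1 (A - B) := by
    intro B
    refine Finset.sum_le_sum fun j _ => Finset.sum_le_sum fun i _ => ?_
    by_cases h : B i j = 0 <;> simp [keep, supp, h]
  let F : Finset (Finset (Fin n × Fin m)) := Finset.univ.filter fun T => IsSparseMatrix s (keep T)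
  have h0 : IsSparseMatrix s (0 : Matrix (Fin n) (Fin m) ℝ) := by
    simp [IsSparseMatrix, matrixL0, hammingNorm, Matrix.col]
  have hF : F.Nonempty := ⟨supp 0, by simpa [F] using hkeep 0 h0⟩
  obtain ⟨T, hT, hmin⟩ := F.exists_min_image (fun T => matrixL1 (A - keep T)) hF
  have hl : IsLeast (sparseErrors s A) (matrixL1 (A - keep T)) := by
    refine ⟨⟨keep T, by simpa [F] using hT, rfl⟩, ?_⟩
    rintro e ⟨B, hB, rfl⟩
    exact (hmin (supp B) (by simpa [F] using hkeep B hB)).trans (herr B)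
  have : sparseOpt s A = matrixL1 (A - keep T) := hl.csInf_eq
  rwa [this]

/-- A deterministic adaptive scheme for a matrix with columns `A₁, …, Aₘ ∈ ℝⁿ`.
It either ends with an output matrix, or performs one more round: it chooses for every column `j`
a sensing matrix `S j` with `t j` rows, and goes on in a way that may depend on all the answers
`S j *ᵥ Aⱼ`. The unknown matrix is accessed in no other way. -/
inductive AdaptiveScheme (n m : ℕ) : Type
  | done (out : Matrix (Fin n) (Fin m) ℝ) : AdaptiveScheme n m
  | round (t : Fin m → ℕ) (S : (j : Fin m) → Matrix (Fin (t j)) (Fin n) ℝ)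
      (next : ((j : Fin m) → Fin (t j) → ℝ) → AdaptiveScheme n m) : AdaptiveScheme n m

namespace AdaptiveScheme

/-- The matrix that the scheme outputs when it is run on `A`. -/
def output {n m : ℕ} : AdaptiveScheme n m → Matrix (Fin n) (Fin m) ℝ → Matrix (Fin n) (Fin m) ℝ
  | done out, _ => out
  | round _ S next, A => (next fun j => (S j).mulVec (A.col j)).output A

/-- The total number of linear measurements performed when the scheme is run on `A`. -/
def measurements {n m : ℕ} : AdaptiveScheme n m → Matrix (Fin n) (Fin m) ℝ → ℕ
  | done _, _ => 0
  | round t S next, A => (∑ j, t j) + (next fun j => (S j).mulVec (A.col j)).measurements A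

/-- The number of adaptive rounds performed when the scheme is run on `A`. -/
def rounds {n m : ℕ} : AdaptiveScheme n m → Matrix (Fin n) (Fin m) ℝ → ℕ
  | done _, _ => 0
  | round _ S next, A => 1 + (next fun j => (S j).mulVec (A.col j)).rounds A

end AdaptiveScheme

/-- A randomized adaptive scheme: a random seed `ω`, drawn from a probability space without
reference to the input, selects a deterministic adaptive scheme. The output is a jointly measurable
function of the seed and of (the entries of) the input. -/
structure RandomizedScheme (n m : ℕ) where
  /-- the space of random seeds -/
  Seed : Type
  [measurableSpace : MeasurableSpace Seed]
  /-- the law of the random seed -/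
  law : Measure Seed
  [isProbabilityMeasure : IsProbabilityMeasure law]
  /-- the deterministic scheme selected by a seed -/
  scheme : Seed → AdaptiveScheme n m
  measurable_output : ∀ (i : Fin n) (j : Fin m),
    Measurable fun p : Seed × (Fin n → Fin m → ℝ) => (scheme p.1).output (Matrix.of p.2) i j

end

/-!
The scheme combines a deterministic recovery of sparse columns with a randomized test of how good
the recovery is.

*Recovery.* For every sparsity `K` there is a fixed matrix `S` with `O(K log n)` rows that does not
increase the `ℓ₁`-norm of any vector and at most halves that of `2 K`-sparse vectors
(`exists_rip_matrix`): it is the adjacency matrix of a family of `O(log n)` hash functions into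
`O(K)` buckets with few collisions on all small sets, which exists by a union bound. Any
`K`-sparse `z` that nearly minimizes `‖S z - S x‖₁` is then a recovery of `x` up to a constant
factor of its best `K`-sparse approximation; such a `z` is chosen measurably
(`exists_sparse_recovery`).

*Test.* A linear functional with independent coefficients `± n / u`, where `u` is uniform in
`{1, …, n}`, behaves like a `1`-stable one: on a fixed vector `x` it is rarely much larger than
`‖x‖₁`, and it is at least `‖x‖₁ / 10` almost half of the time. The `s`-th largest of `4 s` such
values is therefore within a constant factor of `‖x‖₁` up to an exponentially small probability
(`card_kthLargest_randomSketch_le`).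

*Rounds.* Round `r` recovers the active columns with sparsity `k 2 ^ r`, and keeps active only the
`2 ⌊m / 2 ^ r⌋` columns with the largest estimated errors. Compare with an optimal approximation,
with sparsity `w j` and error `e j` in column `j`. At most `⌊m / 2 ^ r⌋` columns have
`w j > k 2 ^ r`, so if such a column is dropped, at least as many columns with a good recovery have
a comparable error, which is thus `O(∑ e / ⌊m / 2 ^ r⌋)`. This is at most the fraction
`w j / (k m)` of `O(∑ e)`, and these fractions add up to at most `1` (`error_le_of_dropped`). No
loss accumulates over the rounds. A final sparsification costs another constant factor.

As the recovery is deterministic, the errors to be estimated are determined by the input and the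
round. One family of random functionals thus serves all columns and rounds, a union bound over
these suffices, and no independence between rounds is needed. The number of functionals is
`O(log n + log m)`, independent of the sparsity, and its total cost is geometric in the rounds.
-/

/-! ### Hash families with few collisions -/

/-- Resampling one value of a uniformly random function does not change its distribution. -/
lemma sum_sum_update {ι κ M : Type*} [Fintype ι] [DecidableEq ι] [Fintype κ] [AddCommMonoid M]
    (F : (ι → κ) → M) (a : ι) :
    ∑ f : ι → κ, ∑ v, F (Function.update f a v) = Fintype.card κ • ∑ f, F f := by
  have hres : ∑ p : (ι → κ) × κ, F (Function.update p.1 a p.2) = ∑ p : (ι → κ) × κ, F p.1 := by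
    refine Fintype.sum_bijective
      (fun p : (ι → κ) × κ => (Function.update p.1 a p.2, p.1 a)) ?_ _ _ ?_
    · apply Function.Involutive.bijective
      rintro ⟨f, v⟩
      simp
    · rintro ⟨f, v⟩
      rfl
  rw [← Fintype.sum_prod_type', hres, Fintype.sum_prod_type, Finset.smul_sum]
  simp

/-- Exponential moment of the number `|U| - |f(U)|` of collisions of a uniformly random function `f`
on a set `U`, written as a count: inserting the elements of `U` one at a time, each new element
falls on one of the at most `s` occupied values with probability at most `s / B`. -/
lemma sum_pow_collisions_le {n B : ℕ} (t s : ℕ) (ht : 1 ≤ t) (U : Finset (Fin n))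
    (hU : U.card ≤ s) :
    (∑ f : Fin n → Fin B, t ^ (U.card - (U.image f).card)) * B ^ U.card
      ≤ B ^ n * (B + t * s) ^ U.card := by
  classical
  induction U using Finset.induction_on with
  | empty => simp
  | insert a U ha ih =>
    have hc : (insert a U).card = U.card + 1 := Finset.card_insert_of_notMem ha
    rw [hc] at hU ⊢
    have ih := ih (by omega)
    set F : (Fin n → Fin B) → ℕ := fun f => t ^ (U.card + 1 - ((insert a U).image f).card) with hF
    have himg : ∀ (f : Fin n → Fin B) (v : Fin B), (insert a U).image (Function.update f a v)
        = insert v (U.image f) := by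
      intro f v
      rw [Finset.image_insert, Function.update_self]
      congr 1
      refine Finset.image_congr fun i hi => ?_
      rw [Function.update_of_ne]
      rintro rfl
      exact ha (by simpa using hi)
    have hstep : ∀ f : Fin n → Fin B, ∑ v : Fin B, F (Function.update f a v)
        ≤ t ^ (U.card - (U.image f).card) * (B + t * s) := by
      intro f
      have hle : (U.image f).card ≤ U.card := Finset.card_image_le
      have h1 : ∀ v : Fin B, F (Function.update f a v) ≤
          t ^ (U.card - (U.image f).card) * (1 + if v ∈ U.image f then t else 0) := by
        intro v
        simp only [hF, himg]
        by_cases hv : v ∈ U.image f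
        · rw [Finset.insert_eq_of_mem hv, if_pos hv,
            show U.card + 1 - (U.image f).card = U.card - (U.image f).card + 1 by omega, pow_succ]
          exact Nat.mul_le_mul_left _ (by omega)
        · rw [Finset.card_insert_of_notMem hv, if_neg hv,
            show U.card + 1 - ((U.image f).card + 1) = U.card - (U.image f).card by omega]
          simp
      refine (Finset.sum_le_sum fun v _ => h1 v).trans ?_
      rw [← Finset.mul_sum, Finset.sum_add_distrib, ← Finset.sum_filter]
      simp only [Finset.sum_const, Finset.card_univ, Fintype.card_fin, smul_eq_mul, mul_one,
        Finset.filter_mem_eq_inter, Finset.univ_inter]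
      refine Nat.mul_le_mul_left _ ?_
      have : (U.image f).card ≤ s := by omega
      nlinarith
    have hBF : (∑ f, F f) * B ≤ (∑ f : Fin n → Fin B, t ^ (U.card - (U.image f).card))
        * (B + t * s) := by
      have hres := sum_sum_update F a
      rw [Fintype.card_fin, smul_eq_mul] at hres
      rw [mul_comm, ← hres, Finset.sum_mul]
      exact Finset.sum_le_sum fun f _ => hstep f
    calc (∑ f, F f) * B ^ (U.card + 1) = ((∑ f, F f) * B) * B ^ U.card := by ring
      _ ≤ ((∑ f : Fin n → Fin B, t ^ (U.card - (U.image f).card)) * (B + t * s)) * B ^ U.card :=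
          Nat.mul_le_mul_right _ hBF
      _ = ((∑ f : Fin n → Fin B, t ^ (U.card - (U.image f).card)) * B ^ U.card) * (B + t * s) := by
          ring
      _ ≤ (B ^ n * (B + t * s) ^ U.card) * (B + t * s) := Nat.mul_le_mul_right _ ih
      _ = _ := by ring

/-- The number of collisions of the elements of `U` under the hash functions `h 0, …, h (d-1)`. -/
def collisions {n B d : ℕ} (h : Fin d → Fin n → Fin B) (U : Finset (Fin n)) : ℕ :=
  ∑ l, (U.card - (U.image (h l)).card)

/-- Only a fraction `4 ^ (-d|U|)` of the hash families has more than `d|U|/4` collisions on `U`. -/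
lemma card_many_collisions_le {n d : ℕ} (s : ℕ) (hs : 1 ≤ s) (U : Finset (Fin n))
    (hU : U.card ≤ s) :
    (Finset.univ.filter fun h : Fin d → Fin n → Fin (4096 * s) =>
        U.card * d < 4 * collisions h U).card * 4 ^ (U.card * d)
      ≤ Fintype.card (Fin d → Fin n → Fin (4096 * s)) := by
  classical
  set B := 4096 * s with hB
  set u := U.card
  set bad := Finset.univ.filter fun h : Fin d → Fin n → Fin B => u * d < 4 * collisions h U
  have hm := sum_pow_collisions_le (B := B) 4096 s (by norm_num) U hU
  have h1 : (∑ f : Fin n → Fin B, 4096 ^ (u - (U.image f).card)) * B ^ u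
      ≤ B ^ n * 2 ^ u * B ^ u := by
    refine hm.trans (le_of_eq ?_)
    have h2B : B + 4096 * s = 2 * B := by omega
    rw [h2B, mul_pow 2 B, ← mul_assoc]
  have hB0 : 0 < B := by omega
  have h2 : (∑ f : Fin n → Fin B, 4096 ^ (u - (U.image f).card)) ≤ B ^ n * 2 ^ u :=
    Nat.le_of_mul_le_mul_right h1 (pow_pos hB0 _)
  have h3 : ∑ h : Fin d → Fin n → Fin B, 4096 ^ collisions h U ≤ (B ^ n * 2 ^ u) ^ d := by
    refine le_trans (le_of_eq ?_) (Nat.pow_le_pow_left h2 d)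
    rw [← Fin.prod_const, Finset.prod_univ_sum]
    simp [collisions, Finset.prod_pow_eq_pow_sum, u]
  have h4 : bad.card * 8 ^ (u * d) ≤ ∑ h : Fin d → Fin n → Fin B, 4096 ^ collisions h U := by
    rw [← smul_eq_mul, ← Finset.sum_const]
    refine (Finset.sum_le_sum fun h hh => ?_).trans
      (Finset.sum_le_sum_of_subset (Finset.subset_univ bad))
    have hh : u * d < 4 * collisions h U := (Finset.mem_filter.1 hh).2
    calc 8 ^ (u * d) ≤ 8 ^ (4 * collisions h U) := Nat.pow_le_pow_right (by norm_num) hh.le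
      _ = 4096 ^ collisions h U := by rw [pow_mul]; norm_num
  have h5 : bad.card * 4 ^ (u * d) * 2 ^ (u * d) ≤ B ^ (n * d) * 2 ^ (u * d) := by
    calc bad.card * 4 ^ (u * d) * 2 ^ (u * d) = bad.card * 8 ^ (u * d) := by
          rw [mul_assoc, ← mul_pow]; norm_num
      _ ≤ (B ^ n * 2 ^ u) ^ d := h4.trans h3
      _ = _ := by rw [mul_pow, pow_mul, pow_mul]
  refine (Nat.le_of_mul_le_mul_right h5 (by positivity)).trans (le_of_eq ?_)
  simp [pow_mul]

/-- There is a family of `d = O(log n)` hash functions into `O(s)` buckets under which every set of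
at most `s` elements has few collisions; it is the adjacency of a lossless expander. -/
lemma exists_few_collisions (n d s : ℕ) (hs : 1 ≤ s) (hd : 2 * n ≤ 4 ^ d) :
    ∃ h : Fin d → Fin n → Fin (4096 * s), ∀ U : Finset (Fin n), U.card ≤ s →
      4 * collisions h U ≤ U.card * d := by
  classical
  by_contra! hcon
  set H := Fin d → Fin n → Fin (4096 * s)
  set bad : Finset (Fin n) → Finset H := fun U =>
    Finset.univ.filter fun h : H => U.card * d < 4 * collisions h U
  set G : Finset (Finset (Fin n)) := Finset.univ.filter fun U => U.card ≤ s ∧ U.Nonempty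
  have hcov : (Finset.univ : Finset H) ⊆ G.biUnion bad := by
    intro h _
    obtain ⟨U, hU, hUc⟩ := hcon h
    refine Finset.mem_biUnion.2 ⟨U, ?_, by simpa [bad] using hUc⟩
    simp only [G, Finset.mem_filter, Finset.mem_univ, true_and]
    refine ⟨hU, Finset.nonempty_iff_ne_empty.2 ?_⟩
    rintro rfl
    simp [collisions] at hUc
  have hH : (0 : ℝ) < Fintype.card H := by
    have : Nonempty H := ⟨fun _ _ => ⟨0, by omega⟩⟩
    exact_mod_cast Fintype.card_pos
  have h1 : (Fintype.card H : ℝ) ≤ ∑ U ∈ G, ((bad U).card : ℝ) := by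
    exact_mod_cast (Finset.card_le_card hcov).trans Finset.card_biUnion_le
  have h2 : ∀ U ∈ G, ((bad U).card : ℝ) ≤ Fintype.card H * ((4 ^ d)⁻¹ : ℝ) ^ U.card := by
    intro U hU
    have h := card_many_collisions_le (d := d) s hs U (Finset.mem_filter.1 hU).2.1
    have h' : ((bad U).card : ℝ) * 4 ^ (U.card * d) ≤ Fintype.card H := by exact_mod_cast h
    rw [inv_pow, ← pow_mul, mul_comm d, ← div_eq_mul_inv, le_div_iff₀ (by positivity)]
    exact h'
  have h3 : ∑ U ∈ G, ((4 ^ d)⁻¹ : ℝ) ^ U.card ≤ (1 + (4 ^ d : ℝ)⁻¹) ^ n - 1 := by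
    have hall : ∑ U : Finset (Fin n), ((4 ^ d)⁻¹ : ℝ) ^ U.card = (1 + (4 ^ d : ℝ)⁻¹) ^ n := by
      have := Fintype.sum_pow_mul_eq_add_pow (Fin n) ((4 ^ d)⁻¹ : ℝ) 1
      simpa [add_comm] using this
    rw [← hall, le_sub_iff_add_le,
      ← Finset.add_sum_erase Finset.univ _ (Finset.mem_univ (∅ : Finset (Fin n))), add_comm]
    simp only [Finset.card_empty, pow_zero]
    gcongr
    intro U hU
    simp only [G, Finset.mem_filter, Finset.mem_univ, true_and] at hU
    simp [Finset.nonempty_iff_ne_empty.1 hU.2]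
  have h4 : (1 + (4 ^ d : ℝ)⁻¹) ^ n < 2 := by
    have hx : (n : ℝ) * (4 ^ d : ℝ)⁻¹ ≤ 1 / 2 := by
      have : (2 * n : ℝ) ≤ 4 ^ d := by exact_mod_cast hd
      rw [← div_eq_mul_inv, div_le_div_iff₀ (by positivity) (by norm_num)]
      linarith
    calc (1 + (4 ^ d : ℝ)⁻¹) ^ n ≤ (Real.exp ((4 ^ d : ℝ)⁻¹)) ^ n := by
          gcongr
          rw [add_comm]
          exact Real.add_one_le_exp _
      _ = Real.exp (n * (4 ^ d : ℝ)⁻¹) := by rw [← Real.exp_nat_mul]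
      _ ≤ Real.exp (1 / 2) := Real.exp_le_exp.2 hx
      _ < 2 := by
        have h := Real.exp_one_lt_d9
        have h' : Real.exp (1 / 2) * Real.exp (1 / 2) = Real.exp 1 := by
          rw [← Real.exp_add]; norm_num
        nlinarith [Real.exp_pos (1 / 2)]
  have h5 : (Fintype.card H : ℝ) ≤ Fintype.card H * ((1 + (4 ^ d : ℝ)⁻¹) ^ n - 1) := by
    refine (h1.trans (Finset.sum_le_sum h2)).trans ?_
    rw [← Finset.mul_sum]
    gcongr
  nlinarith

/-! ### The restricted isometry property in the `ℓ₁`-norm -/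

/-- The `ℓ₁`-norm of a vector. -/
noncomputable def vecL1 {ι : Type*} [Fintype ι] (x : ι → ℝ) : ℝ := ∑ i, |x i|

lemma vecL1_nonneg {ι : Type*} [Fintype ι] (x : ι → ℝ) : 0 ≤ vecL1 x :=
  Finset.sum_nonneg fun _ _ => abs_nonneg _

lemma vecL1_sub_comm {ι : Type*} [Fintype ι] (x y : ι → ℝ) : vecL1 (x - y) = vecL1 (y - x) :=
  Finset.sum_congr rfl fun _ _ => abs_sub_comm _ _

lemma vecL1_sub_le {ι : Type*} [Fintype ι] (x y z : ι → ℝ) :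
    vecL1 (x - z) ≤ vecL1 (x - y) + vecL1 (y - z) := by
  unfold vecL1
  rw [← Finset.sum_add_distrib]
  exact Finset.sum_le_sum fun _ _ => abs_sub_le _ _ _

/-- Summation by parts: if the sums of `g` over all super-level sets of the weight `w ≥ 0` are
non-negative, then so is the weighted sum. -/
lemma sum_mul_nonneg_of_levelSets {ι : Type*} (g : ι → ℝ) (T : Finset ι) :
    ∀ w : ι → ℝ, (∀ i ∈ T, 0 ≤ w i) →
      (∀ U ⊆ T, (∀ i ∈ U, ∀ j ∈ T, w i ≤ w j → j ∈ U) → 0 ≤ ∑ i ∈ U, g i) →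
      0 ≤ ∑ i ∈ T, g i * w i := by
  classical
  induction T using Finset.strongInduction with
  | H T ih =>
    intro w hw hg
    rcases T.eq_empty_or_nonempty with rfl | hT
    · simp
    obtain ⟨a, haT, ha⟩ := T.exists_min_image w hT
    set T' := T.filter fun i => w a < w i with hT'
    have hsub : T' ⊂ T := by
      refine Finset.filter_ssubset.2 ⟨a, haT, lt_irrefl _⟩
    have h1 : 0 ≤ ∑ i ∈ T', g i * (w i - w a) := by
      refine ih T' hsub (fun i => w i - w a) (fun i hi => ?_) fun U hU hup => ?_
      · have := (Finset.mem_filter.1 hi).2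
        linarith
      · refine hg U (hU.trans hsub.1) fun i hi j hj hij => ?_
        have hwi : w a < w i := (Finset.mem_filter.1 (hU hi)).2
        exact hup i hi j (Finset.mem_filter.2 ⟨hj, hwi.trans_le hij⟩) (by linarith)
    have h2 : ∑ i ∈ T', g i * (w i - w a) = ∑ i ∈ T, g i * (w i - w a) := by
      refine Finset.sum_subset (Finset.filter_subset _ _) fun i hi hi' => ?_
      have : w i = w a := by
        refine le_antisymm ?_ (ha i hi)
        by_contra! hlt
        exact hi' (Finset.mem_filter.2 ⟨hi, hlt⟩)
      rw [this, sub_self, mul_zero]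
    have h3 : 0 ≤ ∑ i ∈ T, g i := hg T subset_rfl fun _ _ j hj _ => hj
    have h4 : ∑ i ∈ T, g i * w i = ∑ i ∈ T, g i * (w i - w a) + w a * ∑ i ∈ T, g i := by
      rw [Finset.mul_sum, ← Finset.sum_add_distrib]
      exact Finset.sum_congr rfl fun i _ => by ring
    rw [h4, ← h2]
    have := mul_nonneg (hw a haT) h3
    linarith

/-- If at most one entry of a bucket is good, the absolute value of the sum over the bucket is at
least the size of the good entry minus the sizes of all others. -/
lemma sum_good_sub_sum_bad_le_abs {ι : Type*} (T : Finset ι) (z : ι → ℝ) (good : ι → Prop)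
    [DecidablePred good] (hgood : ∀ i ∈ T, ∀ j ∈ T, good i → good j → i = j) :
    ∑ i ∈ T, (if good i then |z i| else -|z i|) ≤ |∑ i ∈ T, z i| := by
  classical
  by_cases h : ∃ a ∈ T, good a
  · obtain ⟨a, haT, ha⟩ := h
    rw [← Finset.add_sum_erase T _ haT, ← Finset.add_sum_erase T z haT, if_pos ha]
    have h1 : ∑ i ∈ T.erase a, (if good i then |z i| else -|z i|) = - ∑ i ∈ T.erase a, |z i| := by
      rw [← Finset.sum_neg_distrib]
      refine Finset.sum_congr rfl fun i hi => if_neg fun hgi => ?_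
      exact (Finset.mem_erase.1 hi).1 (hgood i (Finset.mem_erase.1 hi).2 a haT hgi ha)
    have h2 := Finset.abs_sum_le_sum_abs z (T.erase a)
    have h3 := abs_sub_abs_le_abs_sub (z a) (-∑ i ∈ T.erase a, z i)
    rw [abs_neg, sub_neg_eq_add] at h3
    linarith
  · push Not at h
    refine le_trans (Finset.sum_nonpos fun i hi => ?_) (abs_nonneg _)
    rw [if_neg (h i hi)]
    simp

/-- The lower half of the restricted isometry property: the bucket sums of a sparse vector under a
family with few collisions retain half of its `ℓ₁`-norm. In every bucket one largest entry is good
and all others are bad; a super-level set `U` of `|z|` contains the good entry of every bucket that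
it meets, so it has at most as many bad entries as collisions. -/
lemma vecL1_le_sum_buckets {n d B : ℕ} (h : Fin d → Fin n → Fin B) (s : ℕ)
    (hh : ∀ U : Finset (Fin n), U.card ≤ s → 4 * collisions h U ≤ U.card * d)
    (z : Fin n → ℝ) (hz : hammingNorm z ≤ s) :
    d * vecL1 z ≤ 2 * ∑ l, ∑ b, |∑ i, if h l i = b then z i else 0| := by
  classical
  rcases isEmpty_or_nonempty (Fin n) with hn | hn
  · simp only [vecL1, Finset.univ_eq_empty, Finset.sum_empty, mul_zero]
    positivity
  set T : Finset (Fin n) := Finset.univ.filter fun i => z i ≠ 0 with hT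
  have hTs : T.card ≤ s := hz
  -- a largest entry of each bucket
  have hrep : ∀ (l : Fin d) (b : Fin B), (∃ i ∈ T, h l i = b) → ∃ a : Fin n,
      a ∈ T ∧ h l a = b ∧ ∀ i ∈ T, h l i = b → |z i| ≤ |z a| := by
    rintro l b ⟨i, hi, hib⟩
    obtain ⟨a, ha, hmax⟩ := (T.filter fun i => h l i = b).exists_max_image (fun i => |z i|)
      ⟨i, Finset.mem_filter.2 ⟨hi, hib⟩⟩
    rw [Finset.mem_filter] at ha
    exact ⟨a, ha.1, ha.2, fun i hi hib => hmax i (Finset.mem_filter.2 ⟨hi, hib⟩)⟩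
  choose! rep hrepT hrepb hrepmax using hrep
  set good : Fin d → Fin n → Prop := fun l i => rep l (h l i) = i with hgood
  have hbucket : ∀ l, ∑ i ∈ T, (if good l i then |z i| else -|z i|) ≤
      ∑ b, |∑ i, if h l i = b then z i else 0| := by
    intro l
    rw [← Finset.sum_fiberwise T (h l)]
    refine Finset.sum_le_sum fun b _ => ?_
    have h1 : (∑ i, if h l i = b then z i else 0) = ∑ i ∈ T with h l i = b, z i := by
      rw [← Finset.sum_filter]
      refine (Finset.sum_subset (Finset.filter_subset_filter _ (Finset.subset_univ _))
        fun i hi hi' => ?_).symm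
      by_contra hzi
      exact hi' (by simpa [hT, hzi] using hi)
    rw [h1]
    refine sum_good_sub_sum_bad_le_abs _ z (good l) fun i hi j hj hgi hgj => ?_
    rw [Finset.mem_filter] at hi hj
    rw [← (hgi : rep l (h l i) = i), ← (hgj : rep l (h l j) = j), hi.2, hj.2]
  have hlevel : 0 ≤ ∑ i ∈ T, ((∑ l, if good l i then (1 : ℝ) else -1) - d / 2) * |z i| := by
    refine sum_mul_nonneg_of_levelSets _ T (fun i => |z i|) (fun _ _ => abs_nonneg _)
      fun U hU hup => ?_
    have hcount : ∀ l, (U.card : ℝ) - 2 * ((U.card - (U.image (h l)).card : ℕ) : ℝ) ≤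
        ∑ i ∈ U, if good l i then (1 : ℝ) else -1 := by
      intro l
      have himg : (U.image (h l)).card ≤ (U.filter (good l)).card := by
        refine Finset.card_le_card_of_injOn (rep l) (fun b hb => ?_) fun b hb b' hb' heq => ?_
        · obtain ⟨i, hi, rfl⟩ := Finset.mem_image.1 hb
          have hex : ∃ i' ∈ T, h l i' = h l i := ⟨i, hU hi, rfl⟩
          refine Finset.mem_coe.2 (Finset.mem_filter.2 ⟨?_, ?_⟩)
          · exact hup i hi _ (hrepT l _ hex) (hrepmax l _ hex i (hU hi) rfl)
          · simp only [hgood]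
            rw [hrepb l _ hex]
        · obtain ⟨i, hi, rfl⟩ := Finset.mem_image.1 hb
          obtain ⟨i', hi', rfl⟩ := Finset.mem_image.1 hb'
          rw [← hrepb l (h l i) ⟨i, hU hi, rfl⟩, heq, hrepb l (h l i') ⟨i', hU hi', rfl⟩]
      have hle : (U.image (h l)).card ≤ U.card := Finset.card_image_le
      have hsum : ∑ i ∈ U, (if good l i then (1 : ℝ) else -1)
          = 2 * ((U.filter (good l)).card : ℝ) - U.card := by
        have : ∀ i, (if good l i then (1 : ℝ) else -1) = 2 * (if good l i then 1 else 0) - 1 := by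
          intro i; split_ifs <;> norm_num
        simp only [this]
        rw [Finset.sum_sub_distrib, ← Finset.mul_sum, Finset.sum_boole]
        simp
      rw [hsum, Nat.cast_sub hle]
      have : ((U.image (h l)).card : ℝ) ≤ ((U.filter (good l)).card : ℝ) := by exact_mod_cast himg
      linarith
    have hcoll : 4 * (collisions h U : ℝ) ≤ U.card * d := by
      exact_mod_cast hh U ((Finset.card_le_card hU).trans hTs)
    rw [Finset.sum_sub_distrib, Finset.sum_comm]
    have := Finset.sum_le_sum fun l (_ : l ∈ Finset.univ) => hcount l
    rw [Finset.sum_sub_distrib, ← Finset.mul_sum] at this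
    rw [collisions, Nat.cast_sum] at hcoll
    simp only [Finset.sum_const, Finset.card_univ, Fintype.card_fin, nsmul_eq_mul] at this ⊢
    linarith
  have hvec : vecL1 z = ∑ i ∈ T, |z i| := by
    refine (Finset.sum_subset (Finset.subset_univ T) fun i _ hi => ?_).symm
    simpa [hT] using hi
  have htotal := Finset.sum_le_sum fun l (_ : l ∈ Finset.univ) => hbucket l
  have hexp : ∑ i ∈ T, ((∑ l, if good l i then (1 : ℝ) else -1) - d / 2) * |z i|
      = (∑ l, ∑ i ∈ T, if good l i then |z i| else -|z i|) - d / 2 * vecL1 z := by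
    rw [hvec, Finset.mul_sum, Finset.sum_comm, ← Finset.sum_sub_distrib]
    refine Finset.sum_congr rfl fun i _ => ?_
    rw [sub_mul, Finset.sum_mul]
    congr 1
    exact Finset.sum_congr rfl fun l _ => by split_ifs <;> ring
  rw [hexp] at hlevel
  linarith

/-- The sensing matrix of a hash family: the row `(l, b)` adds up the entries that the hash function
`h l` puts into the bucket `b`; the factor `1 / d` makes the columns unit vectors of `ℓ₁`. -/
noncomputable def bucketMatrix {n d B : ℕ} (h : Fin d → Fin n → Fin B) :
    Matrix (Fin d × Fin B) (Fin n) ℝ :=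
  Matrix.of fun p i => if h p.1 i = p.2 then (d : ℝ)⁻¹ else 0

lemma vecL1_bucketMatrix_mulVec {n d B : ℕ} (h : Fin d → Fin n → Fin B) (z : Fin n → ℝ) :
    vecL1 ((bucketMatrix h).mulVec z)
      = (d : ℝ)⁻¹ * ∑ l, ∑ b, |∑ i, if h l i = b then z i else 0| := by
  unfold vecL1
  rw [Fintype.sum_prod_type, Finset.mul_sum]
  refine Finset.sum_congr rfl fun l _ => ?_
  rw [Finset.mul_sum]
  refine Finset.sum_congr rfl fun b _ => ?_
  have hd : (0 : ℝ) ≤ (d : ℝ)⁻¹ := by positivity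
  rw [← abs_of_nonneg hd, ← abs_mul, Finset.mul_sum]
  simp only [bucketMatrix, Matrix.mulVec, dotProduct, Matrix.of_apply]
  congr 1
  refine Finset.sum_congr rfl fun i _ => ?_
  split_ifs <;> simp

/-- There is a deterministic matrix with `O(s log n)` rows that does not increase the `ℓ₁`-norm of
any vector, and at most halves the `ℓ₁`-norm of `s`-sparse vectors. -/
lemma exists_rip_matrix (n d s : ℕ) (hs : 1 ≤ s) (hd1 : 1 ≤ d) (hd : 2 * n ≤ 4 ^ d) :
    ∃ S : Matrix (Fin (d * (4096 * s))) (Fin n) ℝ, (∀ x, vecL1 (S.mulVec x) ≤ vecL1 x) ∧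
      ∀ z, hammingNorm z ≤ s → vecL1 z ≤ 2 * vecL1 (S.mulVec z) := by
  obtain ⟨h, hh⟩ := exists_few_collisions n d s hs hd
  have hd0 : (0 : ℝ) < d := by exact_mod_cast hd1
  have hre : ∀ x, vecL1 (((bucketMatrix h).submatrix finProdFinEquiv.symm id).mulVec x)
      = vecL1 ((bucketMatrix h).mulVec x) := by
    intro x
    exact Equiv.sum_comp finProdFinEquiv.symm fun p => |(bucketMatrix h).mulVec x p|
  refine ⟨(bucketMatrix h).submatrix finProdFinEquiv.symm id, fun x => ?_, fun z hz => ?_⟩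
  · rw [hre, vecL1_bucketMatrix_mulVec, inv_mul_le_iff₀ hd0]
    have h1 : ∀ l, ∑ b, |∑ i, if h l i = b then x i else 0| ≤ vecL1 x := by
      intro l
      calc ∑ b, |∑ i, if h l i = b then x i else 0|
          ≤ ∑ b, ∑ i, if h l i = b then |x i| else 0 := by
            refine Finset.sum_le_sum fun b _ => (Finset.abs_sum_le_sum_abs _ _).trans (le_of_eq ?_)
            exact Finset.sum_congr rfl fun i _ => by split_ifs <;> simp
        _ = vecL1 x := by
            rw [Finset.sum_comm]
            simp [vecL1]
    refine (Finset.sum_le_sum fun l _ => h1 l).trans (le_of_eq ?_)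
    simp
  · rw [hre, vecL1_bucketMatrix_mulVec]
    have h1 := vecL1_le_sum_buckets h s hh z hz
    rw [mul_comm, ← le_div_iff₀ hd0] at h1
    refine h1.trans (le_of_eq ?_)
    rw [div_eq_inv_mul]
    ring

/-! ### Measurable choice from countably many candidates -/

/-- If countably many measurable sets `P i` cover the space, then an index `i` with `ω ∈ P i` can be
chosen measurably. -/
lemma exists_measurable_choice {ι Ω : Type*} [Countable ι] [MeasurableSpace Ω] (P : ι → Set Ω)
    (hP : ∀ i, MeasurableSet (P i)) (hcover : ∀ ω, ∃ i, ω ∈ P i) :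
    ∃ a : Ω → ι, (∀ i, MeasurableSet (a ⁻¹' {i})) ∧ ∀ ω, ω ∈ P (a ω) := by
  classical
  rcases isEmpty_or_nonempty Ω with hΩ | ⟨⟨ω₀⟩⟩
  · exact ⟨fun ω => (hΩ.false ω).elim, fun i => Subsingleton.measurableSet,
      fun ω => (hΩ.false ω).elim⟩
  have : Nonempty ι := ⟨(hcover ω₀).choose⟩
  obtain ⟨f, hf⟩ := exists_surjective_nat ι
  have hex : ∀ ω, ∃ k, ω ∈ P (f k) := by
    intro ω
    obtain ⟨i, hi⟩ := hcover ω
    obtain ⟨k, rfl⟩ := hf i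
    exact ⟨k, hi⟩
  have hm : Measurable fun ω => Nat.find (hex ω) := measurable_find hex fun k => hP (f k)
  refine ⟨fun ω => f (Nat.find (hex ω)), fun i => ?_, fun ω => Nat.find_spec (hex ω)⟩
  exact hm (MeasurableSet.of_discrete (s := f ⁻¹' {i}))

lemma measurable_of_measurable_choice {ι Ω β : Type*} [Countable ι] [MeasurableSpace Ω]
    [MeasurableSpace β] {a : Ω → ι} (ha : ∀ i, MeasurableSet (a ⁻¹' {i})) {G : ι → Ω → β}
    (hG : ∀ i, Measurable (G i)) : Measurable fun ω => G (a ω) ω := by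
  intro s hs
  have : (fun ω => G (a ω) ω) ⁻¹' s = ⋃ i, a ⁻¹' {i} ∩ G i ⁻¹' s := by
    ext ω
    simp
  rw [this]
  exact MeasurableSet.iUnion fun i => (ha i).inter (hG i hs)

/-! ### Deterministic sparse recovery of a single column -/

lemma continuous_vecL1 {ι : Type*} [Fintype ι] : Continuous (vecL1 : (ι → ℝ) → ℝ) :=
  continuous_finsetSum _ fun i _ => (continuous_apply i).abs

lemma vecL1_zero {ι : Type*} [Fintype ι] : vecL1 (0 : ι → ℝ) = 0 := by simp [vecL1]

lemma dist_le_vecL1_sub {ι : Type*} [Fintype ι] (x y : ι → ℝ) : dist x y ≤ vecL1 (x - y) := by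
  refine (dist_pi_le_iff (vecL1_nonneg _)).2 fun i => ?_
  rw [Real.dist_eq]
  exact Finset.single_le_sum (f := fun i => |(x - y) i|) (fun i _ => abs_nonneg _)
    (Finset.mem_univ i)

/-- Measurable sparse regression: a `K`-sparse vector `z` whose measurements `S z` fit `y` in the
`ℓ₁`-norm up to a factor `2` of the best possible, chosen measurably in `y`.
The candidates are the countably many rational sparse vectors and, for every support, a linear
solution operator of `S z = y`. The latter serve the `y` that are fitted exactly, and these form a
closed set; for all other `y` the best possible error is positive, and a rational vector comes
within a factor `2` of it. -/
lemma exists_sparse_regression {n t : ℕ} (S : Matrix (Fin t) (Fin n) ℝ) (K : ℕ) :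
    ∃ dec : (Fin t → ℝ) → Fin n → ℝ, Measurable dec ∧ (∀ y, hammingNorm (dec y) ≤ K) ∧
      ∀ y w, hammingNorm w ≤ K → vecL1 (S.mulVec (dec y) - y) ≤ 2 * vecL1 (S.mulVec w - y) := by
  classical
  let proj : Finset (Fin n) → (Fin n → ℝ) →ₗ[ℝ] (Fin n → ℝ) := fun T =>
    LinearMap.pi fun i => if i ∈ T then LinearMap.proj i else 0
  have hproj : ∀ T z i, proj T z i = if i ∈ T then z i else 0 := by
    intro T z i
    by_cases h : i ∈ T <;> simp [proj, h]
  have hsparse : ∀ T z, hammingNorm (proj T z) ≤ T.card := by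
    intro T z
    refine Finset.card_le_card fun i hi => ?_
    by_contra hiT
    simp [hproj, hiT] at hi
  let f : Finset (Fin n) → (Fin n → ℝ) →ₗ[ℝ] (Fin t → ℝ) := fun T => S.mulVecLin ∘ₗ proj T
  have hsol : ∀ T, ∃ g : (Fin t → ℝ) →ₗ[ℝ] (Fin n → ℝ), ∀ y ∈ LinearMap.range (f T),
      f T (g y) = y := by
    intro T
    obtain ⟨g₀, hg₀⟩ := (f T).rangeRestrict.exists_rightInverse_of_surjective
      (f T).range_rangeRestrict
    obtain ⟨g, hg⟩ := g₀.exists_extend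
    refine ⟨g, fun y hy => ?_⟩
    have h1 : g y = g₀ ⟨y, hy⟩ := LinearMap.congr_fun hg ⟨y, hy⟩
    have h2 := congrArg Subtype.val (LinearMap.congr_fun hg₀ ⟨y, hy⟩)
    rw [h1]
    exact h2
  choose g hg using hsol
  let ι := {T : Finset (Fin n) // T.card ≤ K} × Option (Fin n → ℚ)
  let cand : ι → (Fin t → ℝ) → Fin n → ℝ := fun i y =>
    proj i.1 (i.2.elim (g i.1 y) fun q j => (q j : ℝ))
  let cost : ι → (Fin t → ℝ) → ℝ := fun i y => vecL1 (S.mulVec (cand i y) - y)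
  have hcand : ∀ i, Continuous (cand i) := by
    rintro ⟨T, _ | q⟩
    · exact LinearMap.continuous_of_finiteDimensional (proj T ∘ₗ g T)
    · exact (continuous_const : Continuous fun _ : Fin t → ℝ => proj T fun j => (q j : ℝ))
  have hcost : ∀ i, Continuous (cost i) := by
    intro i
    have h : Continuous fun y => S.mulVec (cand i y) :=
      (LinearMap.continuous_of_finiteDimensional S.mulVecLin).comp (hcand i)
    exact continuous_vecL1.comp (h.sub continuous_id)
  let W : Set (Fin t → ℝ) := ⋃ T : {T : Finset (Fin n) // T.card ≤ K},
    (LinearMap.range (f T) : Set (Fin t → ℝ))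
  have hW : IsClosed W := isClosed_iUnion_of_finite fun T =>
    Submodule.closed_of_finiteDimensional (LinearMap.range (f T))
  have : Nonempty ι := ⟨⟨∅, by simp⟩, none⟩
  let P : ι → Set (Fin t → ℝ) := fun i => {y | ∀ i', cost i y ≤ 2 * cost i' y}
  have hP : ∀ i, MeasurableSet (P i) := by
    intro i
    have : P i = ⋂ i', {y | cost i y ≤ 2 * cost i' y} := by ext; simp [P]
    rw [this]
    exact MeasurableSet.iInter fun i' =>
      measurableSet_le (hcost i).measurable ((hcost i').measurable.const_mul 2)
  have hcover : ∀ y, ∃ i, y ∈ P i := by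
    intro y
    have hbdd : BddBelow (Set.range fun i => cost i y) :=
      ⟨0, by rintro _ ⟨i, rfl⟩; exact vecL1_nonneg _⟩
    rcases (Real.iInf_nonneg fun i => vecL1_nonneg (S.mulVec (cand i y) - y) :
      0 ≤ ⨅ i, cost i y).lt_or_eq with hpos | hzero
    · obtain ⟨i, hi⟩ := exists_lt_of_ciInf_lt
        (show ⨅ i, cost i y < 2 * ⨅ i, cost i y by linarith)
      exact ⟨i, fun i' => hi.le.trans (by gcongr; exact ciInf_le hbdd i')⟩
    · have hy : y ∈ closure W := by
        refine Metric.mem_closure_iff.2 fun ε hε => ?_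
        obtain ⟨i, hi⟩ := exists_lt_of_ciInf_lt (show ⨅ i, cost i y < ε by rwa [← hzero])
        refine ⟨S.mulVec (cand i y), Set.mem_iUnion.2 ⟨i.1, ⟨_, rfl⟩⟩, ?_⟩
        rw [dist_comm]
        exact (dist_le_vecL1_sub _ _).trans_lt hi
      rw [hW.closure_eq] at hy
      obtain ⟨T, hT⟩ := Set.mem_iUnion.1 hy
      refine ⟨⟨T, none⟩, fun i' => ?_⟩
      have h0 : cost ⟨T, none⟩ y = 0 := by
        have : S.mulVec (cand ⟨T, none⟩ y) = y := hg T y hT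
        simp only [cost, this, sub_self, vecL1_zero]
      rw [h0]
      exact mul_nonneg zero_le_two (vecL1_nonneg _)
  obtain ⟨a, ham, haP⟩ := exists_measurable_choice P hP hcover
  refine ⟨fun y => cand (a y) y, measurable_of_measurable_choice ham fun i => (hcand i).measurable,
    fun y => (hsparse _ _).trans (a y).1.2, fun y w hw => ?_⟩
  set T : Finset (Fin n) := Finset.univ.filter fun i => w i ≠ 0 with hT
  have hTw : proj T w = w := by
    ext i
    rw [hproj]
    by_cases h : w i = 0 <;> simp [hT, h]
  have hclosed : IsClosed {v : Fin n → ℝ |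
      cost (a y) y ≤ 2 * vecL1 (S.mulVec (proj T v) - y)} := by
    refine isClosed_le continuous_const (continuous_const.mul (continuous_vecL1.comp ?_))
    exact (LinearMap.continuous_of_finiteDimensional (f T)).sub continuous_const
  have hdense : DenseRange (Pi.map fun (_ : Fin n) (q : ℚ) => (q : ℝ)) :=
    DenseRange.piMap fun _ => Rat.denseRange_cast
  have hall := hdense.induction_on (p := fun v => cost (a y) y ≤
    2 * vecL1 (S.mulVec (proj T v) - y)) w hclosed fun q => haP y ⟨⟨T, hw⟩, some q⟩
  rwa [hTw] at hall

/-- There is a matrix with `O(K log n)` rows from which every vector can be recovered, measurably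
and up to a constant factor of its best `K`-sparse approximation in the `ℓ₁`-norm. -/
lemma exists_sparse_recovery (n d K : ℕ) (hK : 1 ≤ K) (hd1 : 1 ≤ d) (hd : 2 * n ≤ 4 ^ d) :
    ∃ (S : Matrix (Fin (d * (4096 * (2 * K)))) (Fin n) ℝ)
      (dec : (Fin (d * (4096 * (2 * K))) → ℝ) → Fin n → ℝ), Measurable dec ∧
      ∀ x w, hammingNorm w ≤ K → vecL1 (x - dec (S.mulVec x)) ≤ 7 * vecL1 (x - w) := by
  obtain ⟨S, hSle, hS⟩ := exists_rip_matrix n d (2 * K) (by omega) hd1 hd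
  obtain ⟨dec, hm, hsp, hdec⟩ := exists_sparse_regression S K
  refine ⟨S, dec, hm, fun x w hw => ?_⟩
  set z := dec (S.mulVec x)
  have hzw : hammingNorm (z - w) ≤ 2 * K := by
    have h1 := hammingDist_triangle w 0 z
    rw [hammingDist_zero_right, hammingDist_zero_left, hammingDist_eq_hammingNorm, neg_add_eq_sub] at h1
    have : hammingNorm z ≤ K := hsp (S.mulVec x)
    omega
  have h1 := hS (z - w) hzw
  have h2 := hdec (S.mulVec x) w hw
  have h3 := hSle (w - x)
  rw [Matrix.mulVec_sub] at h1 h3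
  have h4 := vecL1_sub_le (S.mulVec z) (S.mulVec x) (S.mulVec w)
  have h5 := vecL1_sub_le x w z
  rw [vecL1_sub_comm w z] at h5
  rw [vecL1_sub_comm (S.mulVec x) (S.mulVec w)] at h4
  rw [vecL1_sub_comm w x] at h3
  linarith

/-! ### A randomized estimator of the `ℓ₁`-norm -/

/-- The sign encoded by a boolean. -/
def boolSign (b : Bool) : ℝ := if b then 1 else -1

lemma sum_boolSign_mul {n : ℕ} (i j : Fin n) :
    ∑ σ : Fin n → Bool, boolSign (σ i) * boolSign (σ j) = if i = j then (2 : ℝ) ^ n else 0 := by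
  split_ifs with h
  · subst h
    have : ∀ b, boolSign b * boolSign b = 1 := by intro b; cases b <;> simp [boolSign]
    simp [this]
  · have := sum_sum_update (fun σ : Fin n → Bool => boolSign (σ i) * boolSign (σ j)) i
    simp only [Function.update_self, Function.update_of_ne (Ne.symm h)] at this
    have hzero : ∀ x : ℝ, ∑ b, boolSign b * x = 0 := by
      intro x
      simp [boolSign]
    simp only [hzero, Finset.sum_const_zero] at this
    simpa using this.symm

/-- The second moment of a sum with random signs. -/
lemma sum_sq_sum_boolSign_mul {n : ℕ} (y : Fin n → ℝ) :
    ∑ σ : Fin n → Bool, (∑ i, boolSign (σ i) * y i) ^ 2 = 2 ^ n * ∑ i, y i ^ 2 := by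
  calc ∑ σ : Fin n → Bool, (∑ i, boolSign (σ i) * y i) ^ 2
      = ∑ σ : Fin n → Bool, ∑ i, ∑ j, (boolSign (σ i) * boolSign (σ j)) * (y i * y j) := by
        refine Finset.sum_congr rfl fun σ _ => ?_
        rw [sq, Finset.sum_mul_sum]
        exact Finset.sum_congr rfl fun i _ => Finset.sum_congr rfl fun j _ => by ring
    _ = ∑ i, ∑ j, (∑ σ : Fin n → Bool, boolSign (σ i) * boolSign (σ j)) * (y i * y j) := by
        rw [Finset.sum_comm]
        refine Finset.sum_congr rfl fun i _ => ?_
        rw [Finset.sum_comm]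
        exact Finset.sum_congr rfl fun j _ => (Finset.sum_mul ..).symm
    _ = 2 ^ n * ∑ i, y i ^ 2 := by
        simp only [sum_boolSign_mul, ite_mul, zero_mul, Finset.sum_ite_eq, Finset.mem_univ, if_true,
          Finset.mul_sum]
        exact Finset.sum_congr rfl fun i _ => by ring

/-- A sum with random signs is rarely much larger than its terms: Chebyshev's inequality, in a form
that is trivial as soon as a single term exceeds the threshold. -/
lemma card_sum_boolSign_gt_le {n : ℕ} (y : Fin n → ℝ) (t : ℝ) (ht : 0 < t) :
    ((Finset.univ.filter fun σ : Fin n → Bool => t < |∑ i, boolSign (σ i) * y i|).card : ℝ)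
      ≤ 2 ^ n * ∑ i, min 1 ((y i / t) ^ 2) := by
  set bad := Finset.univ.filter fun σ : Fin n → Bool => t < |∑ i, boolSign (σ i) * y i|
  by_cases hbig : ∃ i, 1 ≤ (y i / t) ^ 2
  · obtain ⟨i, hi⟩ := hbig
    have h1 : (bad.card : ℝ) ≤ 2 ^ n := by
      have := Finset.card_le_univ bad
      rw [Fintype.card_fun, Fintype.card_bool, Fintype.card_fin] at this
      exact_mod_cast this
    have h2 : (1 : ℝ) ≤ ∑ i, min 1 ((y i / t) ^ 2) := by
      refine (min_eq_left hi).symm.le.trans ?_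
      exact Finset.single_le_sum (f := fun i => min 1 ((y i / t) ^ 2))
        (fun i _ => le_min zero_le_one (sq_nonneg _)) (Finset.mem_univ i)
    calc (bad.card : ℝ) ≤ 2 ^ n * 1 := by simpa using h1
      _ ≤ _ := by gcongr
  · push Not at hbig
    have h1 : ∀ i, min 1 ((y i / t) ^ 2) = y i ^ 2 / t ^ 2 := fun i => by
      rw [min_eq_right (hbig i).le, div_pow]
    simp only [h1]
    rw [← Finset.sum_div, ← mul_div_assoc, ← sum_sq_sum_boolSign_mul, le_div_iff₀ (by positivity),
      ← nsmul_eq_mul, ← Finset.sum_const]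
    refine (Finset.sum_le_sum fun σ hσ => ?_).trans (Finset.sum_le_sum_of_subset_of_nonneg
      (Finset.subset_univ bad) fun _ _ _ => sq_nonneg _)
    have : t < |∑ i, boolSign (σ i) * y i| := (Finset.mem_filter.1 hσ).2
    rw [← sq_abs (∑ i, boolSign (σ i) * y i)]
    gcongr

/-- A sum with random signs is at least as large as any of its terms with probability `1 / 2`, as
flipping the sign of that term changes the sum by twice the term. -/
lemma two_mul_card_sum_boolSign_lt_le {n : ℕ} (y : Fin n → ℝ) (t : ℝ) (a : Fin n)
    (ha : t ≤ |y a|) :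
    2 * (Finset.univ.filter fun σ : Fin n → Bool => |∑ i, boolSign (σ i) * y i| < t).card
      ≤ 2 ^ n := by
  classical
  have h := sum_sum_update
    (fun σ : Fin n → Bool => if |∑ i, boolSign (σ i) * y i| < t then 1 else 0) a
  rw [Finset.sum_boole, Fintype.card_bool, smul_eq_mul, Nat.cast_id] at h
  rw [← h]
  calc _ ≤ ∑ σ : Fin n → Bool, 1 := Finset.sum_le_sum fun σ _ => ?_
    _ = 2 ^ n := by simp
  have hsum : ∀ v, ∑ i, boolSign (Function.update σ a v i) * y i
      = boolSign v * y a + ∑ i ∈ Finset.univ.erase a, boolSign (σ i) * y i := by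
    intro v
    rw [← Finset.add_sum_erase _ _ (Finset.mem_univ a), Function.update_self]
    congr 1
    refine Finset.sum_congr rfl fun i hi => ?_
    rw [Function.update_of_ne (Finset.mem_erase.1 hi).1]
  set r := ∑ i ∈ Finset.univ.erase a, boolSign (σ i) * y i
  simp only [Fintype.sum_bool, hsum]
  by_cases h1 : |boolSign true * y a + r| < t <;> by_cases h2 : |boolSign false * y a + r| < t <;>
    simp only [h1, h2, if_true, if_false] <;> try norm_num
  simp only [boolSign, if_true, Bool.false_eq_true, if_false] at h1 h2
  rw [abs_lt] at h1 h2
  rcases abs_cases (y a) with h | h <;> linarith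

lemma sum_min_one_div_sq_le (b : ℝ) (hb : 0 ≤ b) (N : ℕ) :
    ∑ v ∈ Finset.range N, min 1 ((b / (v + 1)) ^ 2) ≤ 4 * b := by
  rcases hb.eq_or_lt with rfl | hb
  · simp
  have hstep : ∀ v : ℕ, min 1 ((b / (v + 1)) ^ 2)
      ≤ 4 * b * ((v + 1 : ℕ) / ((v + 1 : ℕ) + b)) - 4 * b * (v / (v + b)) := by
    intro v
    have hv : (0 : ℝ) ≤ v := Nat.cast_nonneg v
    have hd : 4 * b * (((v + 1 : ℕ) : ℝ) / ((v + 1 : ℕ) + b)) - 4 * b * (v / (v + b))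
        = 4 * b ^ 2 / ((v + 1 + b) * (v + b)) := by
      push_cast
      field_simp
      ring
    rw [hd]
    by_cases hvb : (v : ℝ) + 1 ≤ b
    · refine (min_le_left _ _).trans ?_
      rw [le_div_iff₀ (by positivity)]
      nlinarith
    · push Not at hvb
      refine (min_le_right _ _).trans ?_
      rw [div_pow, div_le_div_iff₀ (by positivity) (by positivity)]
      have h1 : (v + 1 + b) * (v + b) ≤ (2 * (v + 1)) * (2 * (v + 1)) := by
        gcongr <;> linarith
      nlinarith [mul_le_mul_of_nonneg_left h1 (sq_nonneg b)]
  refine (Finset.sum_le_sum fun v _ => hstep v).trans ?_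
  rw [Finset.sum_range_sub (fun v : ℕ => 4 * b * ((v : ℝ) / (v + b)))]
  have : (N : ℝ) / (N + b) ≤ 1 := (div_le_one (by positivity)).2 (by linarith)
  simp only [Nat.cast_zero, zero_div, mul_zero, sub_zero]
  nlinarith

/-- The seed of one random linear functional: `n` signs and `n` integers in `{0, …, n - 1}`. -/
abbrev FunctionalSeed (n : ℕ) : Type := (Fin n → Bool) × (Fin n → Fin n)

/-- The random coefficients `± n / u` with `u` uniform in `{1, …, n}`. Their tails
`P(|coefficient| ≥ t) ≈ 1 / t` are those of a `1`-stable distribution, so that the functional with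
these coefficients has the size of the `ℓ₁`-norm. -/
noncomputable def randomFunctional {n : ℕ} (ω : FunctionalSeed n) (i : Fin n) : ℝ :=
  boolSign (ω.1 i) * (n / ((ω.2 i : ℕ) + 1))

/-- The random functional exceeds `T ‖x‖₁` with probability at most `4 / T`. -/
lemma card_randomFunctional_gt_le {n : ℕ} (x : Fin n → ℝ) (T : ℝ) (hT : 0 < T) :
    ((Finset.univ.filter fun ω : FunctionalSeed n =>
        T * vecL1 x < |∑ i, randomFunctional ω i * x i|).card : ℝ) * T
      ≤ 4 * Fintype.card (FunctionalSeed n) := by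
  classical
  rcases (vecL1_nonneg x).eq_or_lt with h0 | hpos
  · have hx : ∀ i, x i = 0 := fun i => by
      have := (Finset.sum_eq_zero_iff_of_nonneg fun i _ => abs_nonneg (x i)).1 h0.symm i
        (Finset.mem_univ i)
      simpa using this
    simp only [← h0, hx, mul_zero, Finset.sum_const_zero, abs_zero, lt_self_iff_false,
      Finset.filter_false, Finset.card_empty, Nat.cast_zero, zero_mul]
    positivity
  set t := T * vecL1 x with ht
  have htpos : 0 < t := mul_pos hT hpos
  have hn : 0 < n := by
    rcases Nat.eq_zero_or_pos n with rfl | h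
    · simp [vecL1] at hpos
    · exact h
  have hcount : ((Finset.univ.filter fun ω : FunctionalSeed n =>
      t < |∑ i, randomFunctional ω i * x i|).card : ℝ)
      = ∑ u : Fin n → Fin n, ((Finset.univ.filter fun σ : Fin n → Bool =>
          t < |∑ i, boolSign (σ i) * (n / ((u i : ℕ) + 1) * x i)|).card : ℝ) := by
    simp only [Finset.card_filter, Nat.cast_sum]
    rw [Fintype.sum_prod_type_right]
    simp only [randomFunctional, mul_assoc]
  have hav : ∀ i : Fin n, ∑ u : Fin n → Fin n, min 1 ((n / ((u i : ℕ) + 1) * x i / t) ^ 2)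
      ≤ (n : ℝ) ^ n * (4 * (|x i| / t)) := by
    intro i
    have h := sum_sum_update
      (fun u : Fin n → Fin n => min 1 (((n : ℝ) / ((u i : ℕ) + 1) * x i / t) ^ 2)) i
    simp only [Function.update_self, Finset.sum_const, Finset.card_univ, Fintype.card_fin,
      Fintype.card_fun, nsmul_eq_mul, Nat.cast_pow] at h
    have h1 : ∑ v : Fin n, min 1 (((n : ℝ) / ((v : ℕ) + 1) * x i / t) ^ 2)
        ≤ 4 * (n * (|x i| / t)) := by
      rw [Fin.sum_univ_eq_sum_range
        (fun v : ℕ => min 1 (((n : ℝ) / ((v : ℝ) + 1) * x i / t) ^ 2)) n]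
      refine le_trans (le_of_eq (Finset.sum_congr rfl fun v _ => ?_))
        (sum_min_one_div_sq_le (n * (|x i| / t)) (by positivity) n)
      congr 1
      rw [← sq_abs]
      congr 1
      rw [abs_div, abs_mul, abs_of_pos htpos,
        abs_of_nonneg (by positivity : (0 : ℝ) ≤ (n : ℝ) / ((v : ℝ) + 1))]
      ring
    have hn' : (0 : ℝ) < n := by exact_mod_cast hn
    refine le_of_mul_le_mul_left ?_ hn'
    rw [← h]
    calc _ ≤ (n : ℝ) ^ n * (4 * (n * (|x i| / t))) := by gcongr
      _ = _ := by ring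
  rw [hcount]
  calc (∑ u : Fin n → Fin n, ((Finset.univ.filter fun σ : Fin n → Bool =>
          t < |∑ i, boolSign (σ i) * (n / ((u i : ℕ) + 1) * x i)|).card : ℝ)) * T
      ≤ (∑ u : Fin n → Fin n, 2 ^ n * ∑ i, min 1 ((n / ((u i : ℕ) + 1) * x i / t) ^ 2)) * T := by
        gcongr with u
        exact card_sum_boolSign_gt_le _ t htpos
    _ = 2 ^ n * (∑ i, ∑ u : Fin n → Fin n, min 1 ((n / ((u i : ℕ) + 1) * x i / t) ^ 2)) * T := by
        rw [← Finset.mul_sum, Finset.sum_comm]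
    _ ≤ 2 ^ n * (∑ i, (n : ℝ) ^ n * (4 * (|x i| / t))) * T := by
        gcongr with i
        exact hav i
    _ = 4 * Fintype.card (FunctionalSeed n) := by
        rw [← Finset.mul_sum, ← Finset.mul_sum, ← Finset.sum_div]
        change 2 ^ n * ((n : ℝ) ^ n * (4 * (vecL1 x / t))) * T = _
        have : vecL1 x / t * T = 1 := by
          rw [ht]
          field_simp
        simp only [Fintype.card_prod, Fintype.card_fun, Fintype.card_bool, Fintype.card_fin,
          Nat.cast_mul, Nat.cast_pow, Nat.cast_ofNat]
        linear_combination 4 * 2 ^ n * (n : ℝ) ^ n * this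

lemma card_lt_fin_add_one_le (n : ℕ) (q : ℝ) (hq : 0 ≤ q) (hn : 0 < n) :
    ((Finset.univ.filter fun v : Fin n => q < (v : ℕ) + 1).card : ℝ)
      ≤ n * Real.exp (-(q - 1) / n) := by
  have hn' : (0 : ℝ) < n := by exact_mod_cast hn
  have h1 : (Finset.univ.filter fun v : Fin n => q < (v : ℕ) + 1).card ≤ n - ⌊q⌋₊ := by
    rw [← Nat.card_Ico, ← Finset.card_map Fin.valEmbedding]
    refine Finset.card_le_card fun v hv => ?_
    obtain ⟨w, hw, rfl⟩ := Finset.mem_map.1 hv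
    have hw : q < (w : ℕ) + 1 := (Finset.mem_filter.1 hw).2
    refine Finset.mem_Ico.2 ⟨Nat.lt_succ_iff.1 ((Nat.floor_lt hq).2 ?_), w.2⟩
    simpa using hw
  rcases le_or_gt n ⌊q⌋₊ with h | h
  · rw [Nat.sub_eq_zero_of_le h] at h1
    rw [Nat.le_zero.1 h1]
    simp only [Nat.cast_zero]
    positivity
  · have h2 : ((n - ⌊q⌋₊ : ℕ) : ℝ) = n - ⌊q⌋₊ := Nat.cast_sub h.le
    calc ((Finset.univ.filter fun v : Fin n => q < (v : ℕ) + 1).card : ℝ)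
        ≤ ((n - ⌊q⌋₊ : ℕ) : ℝ) := by exact_mod_cast h1
      _ ≤ n - q + 1 := by rw [h2]; linarith [Nat.lt_floor_add_one q]
      _ = n * (-(q - 1) / n + 1) := by field_simp; ring
      _ ≤ _ := by gcongr; exact Real.add_one_le_exp _

/-- The random functional is smaller than `‖x‖₁ / 10` with probability at most `11 / 20`: with
probability at least `1 - e⁻⁹` some single term is at least that large, and then the sum is so for
one of the two signs of this term. -/
lemma card_randomFunctional_lt_le {n : ℕ} (x : Fin n → ℝ) :
    20 * ((Finset.univ.filter fun ω : FunctionalSeed n =>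
        |∑ i, randomFunctional ω i * x i| < vecL1 x / 10).card : ℝ)
      ≤ 11 * Fintype.card (FunctionalSeed n) := by
  classical
  rcases (vecL1_nonneg x).eq_or_lt with h0 | hpos
  · have hneg : ∀ y : ℝ, ¬ |y| < 0 := fun y => not_lt.2 (abs_nonneg y)
    simp only [← h0, zero_div, hneg, Finset.filter_false, Finset.card_empty, Nat.cast_zero,
      mul_zero]
    positivity
  have hn : 0 < n := by
    rcases Nat.eq_zero_or_pos n with rfl | h
    · simp [vecL1] at hpos
    · exact h
  have hn' : (0 : ℝ) < n := by exact_mod_cast hn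
  set t := vecL1 x / 10 with ht
  have htpos : 0 < t := by positivity
  have hcount : ((Finset.univ.filter fun ω : FunctionalSeed n =>
      |∑ i, randomFunctional ω i * x i| < t).card : ℝ)
      = ∑ u : Fin n → Fin n, ((Finset.univ.filter fun σ : Fin n → Bool =>
          |∑ i, boolSign (σ i) * (n / ((u i : ℕ) + 1) * x i)| < t).card : ℝ) := by
    simp only [Finset.card_filter, Nat.cast_sum]
    rw [Fintype.sum_prod_type_right]
    simp only [randomFunctional, mul_assoc]
  -- the `u` for which all terms are small
  set small : Finset (Fin n → Fin n) :=
    Fintype.piFinset fun i => Finset.univ.filter fun v : Fin n => n * |x i| / t < (v : ℕ) + 1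
  have hsmall : (small.card : ℝ) ≤ (n : ℝ) ^ n / 10 := by
    rw [Fintype.card_piFinset, Nat.cast_prod]
    have hsum : ∑ i, -(n * |x i| / t - 1) / (n : ℝ) = -9 := by
      have h1 : ∀ i, -(n * |x i| / t - 1) / (n : ℝ) = 1 / n - |x i| / t := by
        intro i
        field_simp
        ring
      simp only [h1]
      rw [Finset.sum_sub_distrib, ← Finset.sum_div Finset.univ (fun i => |x i|), Finset.sum_const,
        Finset.card_univ, Fintype.card_fin, nsmul_eq_mul]
      change _ - vecL1 x / t = -9
      rw [ht]
      field_simp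
      norm_num
    calc ∏ i, ((Finset.univ.filter fun v : Fin n => n * |x i| / t < (v : ℕ) + 1).card : ℝ)
        ≤ ∏ i : Fin n, ((n : ℝ) * Real.exp (-(n * |x i| / t - 1) / n)) :=
          Finset.prod_le_prod (fun _ _ => Nat.cast_nonneg _) fun i _ =>
            card_lt_fin_add_one_le n _ (by positivity) hn
      _ = (n : ℝ) ^ n * Real.exp (-9) := by
          rw [Finset.prod_mul_distrib, ← Real.exp_sum, hsum, Fin.prod_const]
      _ ≤ (n : ℝ) ^ n / 10 := by
          rw [div_eq_mul_inv, Real.exp_neg]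
          gcongr
          linarith [Real.add_one_le_exp (9 : ℝ)]
  have hsign : ∀ u : Fin n → Fin n, ((Finset.univ.filter fun σ : Fin n → Bool =>
      |∑ i, boolSign (σ i) * (n / ((u i : ℕ) + 1) * x i)| < t).card : ℝ)
      ≤ 2 ^ n * (1 / 2 + if u ∈ small then 1 / 2 else 0) := by
    intro u
    split_ifs with hu
    · have := Finset.card_le_univ (Finset.univ.filter fun σ : Fin n → Bool =>
        |∑ i, boolSign (σ i) * (n / ((u i : ℕ) + 1) * x i)| < t)
      rw [Fintype.card_fun, Fintype.card_bool, Fintype.card_fin] at this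
      rw [show (1 / 2 + 1 / 2 : ℝ) = 1 by norm_num, mul_one]
      exact_mod_cast this
    · simp only [small, Fintype.mem_piFinset, Finset.mem_filter, Finset.mem_univ, true_and,
        not_forall, not_lt] at hu
      obtain ⟨a, ha⟩ := hu
      have hta : t ≤ |(n : ℝ) / ((u a : ℕ) + 1) * x a| := by
        rw [abs_mul, abs_of_nonneg (by positivity), div_mul_eq_mul_div,
          le_div_iff₀ (by positivity), mul_comm]
        rwa [le_div_iff₀ htpos] at ha
      have h := two_mul_card_sum_boolSign_lt_le
        (fun i => (n : ℝ) / ((u i : ℕ) + 1) * x i) t a hta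
      have h' : 2 * ((Finset.univ.filter fun σ : Fin n → Bool =>
        |∑ i, boolSign (σ i) * (n / ((u i : ℕ) + 1) * x i)| < t).card : ℝ) ≤ 2 ^ n := by
        exact_mod_cast h
      linarith
  rw [hcount]
  have htot := Finset.sum_le_sum fun u (_ : u ∈ Finset.univ) => hsign u
  rw [← Finset.mul_sum, Finset.sum_add_distrib, ← Finset.sum_filter] at htot
  simp only [Finset.sum_const, Finset.card_univ, Finset.filter_mem_eq_inter, Finset.univ_inter,
    Fintype.card_fun, Fintype.card_fin, nsmul_eq_mul, Nat.cast_pow] at htot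
  simp only [Fintype.card_prod, Fintype.card_fun, Fintype.card_bool, Fintype.card_fin,
    Nat.cast_mul, Nat.cast_pow, Nat.cast_ofNat]
  have h2 : (0 : ℝ) < 2 ^ n := by positivity
  nlinarith [mul_le_mul_of_nonneg_left hsmall h2.le]

/-- Chernoff bound for independent repetitions, by the exponential moment with base `2`. -/
lemma card_many_hits_le {α : Type*} [Fintype α] (E : α → Prop) [DecidablePred E] (q a : ℕ) :
    (Finset.univ.filter fun ω : Fin q → α =>
        a ≤ (Finset.univ.filter fun l => E (ω l)).card).card * 2 ^ a
      ≤ (Fintype.card α + (Finset.univ.filter E).card) ^ q := by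
  classical
  set bad := Finset.univ.filter fun ω : Fin q → α =>
    a ≤ (Finset.univ.filter fun l => E (ω l)).card
  have h1 : ∑ v : α, (if E v then 2 else 1) = Fintype.card α + (Finset.univ.filter E).card := by
    have : ∀ v, (if E v then 2 else 1) = 1 + if E v then 1 else 0 := by
      intro v; split_ifs <;> rfl
    simp only [this]
    rw [Finset.sum_add_distrib, Finset.sum_boole]
    simp
  have h2 : ∑ ω : Fin q → α, 2 ^ (Finset.univ.filter fun l => E (ω l)).card
      = (Fintype.card α + (Finset.univ.filter E).card) ^ q := by
    rw [← h1, ← Fin.prod_const, Finset.prod_univ_sum]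
    simp [Finset.prod_ite]
  rw [← h2, ← smul_eq_mul, ← Finset.sum_const]
  refine (Finset.sum_le_sum fun ω hω => ?_).trans
    (Finset.sum_le_sum_of_subset (Finset.subset_univ bad))
  exact Nat.pow_le_pow_right (by norm_num) (Finset.mem_filter.1 hω).2

/-- The `s`-th largest of the numbers `|z l|`, as the maximum over all sets of `s` indices of the
minimum over the set. -/
noncomputable def kthLargest {q : ℕ} (s : ℕ) (hs : 1 ≤ s) (hq : s ≤ q) (z : Fin q → ℝ) : ℝ :=
  (Finset.univ : Finset {T : Finset (Fin q) // T.card = s}).sup'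
    (by
      obtain ⟨T, _, hT⟩ := Finset.exists_subset_card_eq (s := (Finset.univ : Finset (Fin q)))
        (n := s) (by simpa using hq)
      exact ⟨⟨T, hT⟩, Finset.mem_univ _⟩)
    fun T => T.1.inf' (Finset.card_pos.1 (by rw [T.2]; exact hs)) fun l => |z l|

lemma continuous_kthLargest {q : ℕ} (s : ℕ) (hs : 1 ≤ s) (hq : s ≤ q) :
    Continuous (kthLargest (q := q) s hs hq) := by
  unfold kthLargest
  refine Continuous.finset_sup'_apply _ fun T _ => Continuous.finset_inf'_apply _ fun l _ => ?_
  exact (continuous_apply l).abs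

lemma le_kthLargest {q : ℕ} {s : ℕ} (hs : 1 ≤ s) (hq : s ≤ q) (z : Fin q → ℝ) (c : ℝ)
    (h : s ≤ (Finset.univ.filter fun l => c ≤ |z l|).card) : c ≤ kthLargest s hs hq z := by
  obtain ⟨T, hT, hTs⟩ := Finset.exists_subset_card_eq h
  refine (Finset.le_sup'_iff _).2 ⟨⟨T, hTs⟩, Finset.mem_univ _, (Finset.le_inf'_iff _ _).2 ?_⟩
  exact fun l hl => (Finset.mem_filter.1 (hT hl)).2

lemma kthLargest_le {q : ℕ} {s : ℕ} (hs : 1 ≤ s) (hq : s ≤ q) (z : Fin q → ℝ) (c : ℝ)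
    (h : (Finset.univ.filter fun l => c < |z l|).card < s) : kthLargest s hs hq z ≤ c := by
  refine (Finset.sup'_le_iff _ _).2 fun T _ => (Finset.inf'_le_iff _).2 ?_
  by_contra! hcon
  have := Finset.card_le_card fun l (hl : l ∈ T.1) =>
    (Finset.mem_filter.2 ⟨Finset.mem_univ l, hcon l hl⟩ :
      l ∈ Finset.univ.filter fun l => c < |z l|)
  rw [T.2] at this
  omega

/-- The matrix of `q` independent random functionals. -/
noncomputable def randomSketch {n q : ℕ} (ω : Fin q → FunctionalSeed n) :
    Matrix (Fin q) (Fin n) ℝ :=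
  Matrix.of fun l => randomFunctional (ω l)

/-- From `4 s` random functionals, the `s`-th largest absolute value estimates the `ℓ₁`-norm of a
fixed vector up to constants, except with probability `2 (3 / 4) ^ s`. -/
lemma card_kthLargest_randomSketch_le {n s : ℕ} (hs : 1 ≤ s) (hq : s ≤ 4 * s) (x : Fin n → ℝ) :
    ((Finset.univ.filter fun ω : Fin (4 * s) → FunctionalSeed n =>
        ¬ (vecL1 x / 10 ≤ kthLargest s hs hq ((randomSketch ω).mulVec x) ∧
          kthLargest s hs hq ((randomSketch ω).mulVec x) ≤ 80 * vecL1 x)).card : ℝ)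
      ≤ 2 * (3 / 4) ^ s * Fintype.card (Fin (4 * s) → FunctionalSeed n) := by
  classical
  set α := FunctionalSeed n
  set f : α → ℝ := fun ω => |∑ i, randomFunctional ω i * x i| with hf
  have hz : ∀ (ω : Fin (4 * s) → α) l, |(randomSketch ω).mulVec x l| = f (ω l) := fun _ _ => rfl
  set low := Finset.univ.filter fun ω : Fin (4 * s) → α =>
    3 * s ≤ (Finset.univ.filter fun l => f (ω l) < vecL1 x / 10).card
  set high := Finset.univ.filter fun ω : Fin (4 * s) → α =>
    s ≤ (Finset.univ.filter fun l => 80 * vecL1 x < f (ω l)).card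
  have hsub : (Finset.univ.filter fun ω : Fin (4 * s) → α =>
        ¬ (vecL1 x / 10 ≤ kthLargest s hs hq ((randomSketch ω).mulVec x) ∧
          kthLargest s hs hq ((randomSketch ω).mulVec x) ≤ 80 * vecL1 x)) ⊆ low ∪ high := by
    intro ω hω
    by_contra hcon
    simp only [Finset.mem_union, low, high, Finset.mem_filter, Finset.mem_univ, true_and,
      not_or, not_le] at hcon hω
    refine hω ⟨le_kthLargest hs hq _ _ ?_, kthLargest_le hs hq _ _ ?_⟩
    · simp only [hz]
      have := Finset.card_filter_add_card_filter_not (s := (Finset.univ : Finset (Fin (4 * s))))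
        (p := fun l => f (ω l) < vecL1 x / 10)
      simp only [not_lt, Finset.card_univ, Fintype.card_fin] at this
      omega
    · simp only [hz]
      exact hcon.2
  set M : ℝ := (Fintype.card α : ℝ) with hM
  have hM0 : 0 ≤ M := Nat.cast_nonneg _
  have hcard : (Fintype.card (Fin (4 * s) → α) : ℝ) = (M ^ 4) ^ s := by
    rw [Fintype.card_fun, Fintype.card_fin, Nat.cast_pow, ← pow_mul]
  have hlow : (low.card : ℝ) ≤ (3 / 4) ^ s * (M ^ 4) ^ s := by
    have h1 := card_many_hits_le (fun ω : α => f ω < vecL1 x / 10) (4 * s) (3 * s)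
    have h2 : (low.card : ℝ) * 8 ^ s ≤
        ((M + ((Finset.univ.filter fun ω : α => f ω < vecL1 x / 10).card : ℝ)) ^ 4) ^ s := by
      rw [pow_mul, pow_mul, show (2 : ℕ) ^ 3 = 8 from rfl] at h1
      rw [hM]
      exact_mod_cast h1
    have h3 := card_randomFunctional_lt_le x
    have h4 : (M + ((Finset.univ.filter fun ω : α => f ω < vecL1 x / 10).card : ℝ)) ^ 4
        ≤ 6 * M ^ 4 := by
      calc _ ≤ (31 / 20 * M) ^ 4 := by gcongr; linarith
        _ = (31 / 20) ^ 4 * M ^ 4 := mul_pow _ _ _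
        _ ≤ 6 * M ^ 4 := by gcongr; norm_num
    have h5 : (low.card : ℝ) * 8 ^ s ≤ (6 * M ^ 4) ^ s := h2.trans (by gcongr)
    rw [← mul_pow]
    refine le_of_mul_le_mul_right (h5.trans (le_of_eq ?_)) (by positivity : (0 : ℝ) < 8 ^ s)
    rw [← mul_pow]
    congr 1
    ring
  have hhigh : (high.card : ℝ) ≤ (3 / 4) ^ s * (M ^ 4) ^ s := by
    have h1 := card_many_hits_le (fun ω : α => 80 * vecL1 x < f ω) (4 * s) s
    have h2 : (high.card : ℝ) * 2 ^ s ≤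
        ((M + ((Finset.univ.filter fun ω : α => 80 * vecL1 x < f ω).card : ℝ)) ^ 4) ^ s := by
      rw [pow_mul] at h1
      rw [hM]
      exact_mod_cast h1
    have h3 := card_randomFunctional_gt_le x 80 (by norm_num)
    have h4 : (M + ((Finset.univ.filter fun ω : α => 80 * vecL1 x < f ω).card : ℝ)) ^ 4
        ≤ 3 / 2 * M ^ 4 := by
      calc _ ≤ (21 / 20 * M) ^ 4 := by gcongr; linarith
        _ = (21 / 20) ^ 4 * M ^ 4 := mul_pow _ _ _
        _ ≤ 3 / 2 * M ^ 4 := by gcongr; norm_num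
    have h5 : (high.card : ℝ) * 2 ^ s ≤ (3 / 2 * M ^ 4) ^ s := h2.trans (by gcongr)
    rw [← mul_pow]
    refine le_of_mul_le_mul_right (h5.trans (le_of_eq ?_)) (by positivity : (0 : ℝ) < 2 ^ s)
    rw [← mul_pow]
    congr 1
    ring
  calc _ ≤ ((low ∪ high).card : ℝ) := by exact_mod_cast Finset.card_le_card hsub
    _ ≤ (low.card : ℝ) + high.card := by exact_mod_cast Finset.card_union_le _ _
    _ ≤ _ := by rw [hcard]; linarith

/-! ### Measurable selection of columns and entries -/

/-- A set of `min b |a|` elements of `a` with the largest scores `v` can be chosen measurably in `v`: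
it is a subset of this size with the largest total score. -/
lemma exists_topSet {m : ℕ} (b : ℕ) (a : Finset (Fin m)) :
    ∃ sel : (Fin m → ℝ) → Finset (Fin m), (∀ T, MeasurableSet (sel ⁻¹' {T})) ∧
      ∀ v, sel v ⊆ a ∧ (sel v).card = min a.card b ∧
        ∀ i ∈ sel v, ∀ j ∈ a, j ∉ sel v → v j ≤ v i := by
  classical
  have hm : ∀ T : Finset (Fin m), Measurable fun v : Fin m → ℝ => ∑ i ∈ T, v i := fun T =>
    Finset.measurable_sum T fun i _ => measurable_pi_apply i
  let F := a.powersetCard (min a.card b)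
  have hF : F.Nonempty := Finset.powersetCard_nonempty.2 (min_le_left _ _)
  obtain ⟨sel, hsel, hP⟩ := exists_measurable_choice
    (fun T : Finset (Fin m) => {v : Fin m → ℝ | T ∈ F ∧ ∀ T' ∈ F, ∑ i ∈ T', v i ≤ ∑ i ∈ T, v i})
    (fun T => by
      have : {v : Fin m → ℝ | T ∈ F ∧ ∀ T' ∈ F, ∑ i ∈ T', v i ≤ ∑ i ∈ T, v i}
          = {_v | T ∈ F} ∩ ⋂ T' ∈ F, {v : Fin m → ℝ | ∑ i ∈ T', v i ≤ ∑ i ∈ T, v i} := by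
        ext v
        simp
      rw [this]
      exact (MeasurableSet.const _).inter
        (Finset.measurableSet_biInter _ fun T' _ => measurableSet_le (hm T') (hm T)))
    (fun v => by
      obtain ⟨T, hT, hmax⟩ := F.exists_max_image (fun T => ∑ i ∈ T, v i) hF
      exact ⟨T, hT, hmax⟩)
  refine ⟨sel, hsel, fun v => ?_⟩
  obtain ⟨hvF, hmax⟩ := hP v
  obtain ⟨hsub, hcard⟩ := Finset.mem_powersetCard.1 hvF
  refine ⟨hsub, hcard, fun i hi j hj hjn => ?_⟩
  -- otherwise exchanging `i` for `j` would increase the total score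
  have hjn' : j ∉ (sel v).erase i := fun h => hjn (Finset.mem_of_mem_erase h)
  have hex : insert j ((sel v).erase i) ∈ F := by
    refine Finset.mem_powersetCard.2 ⟨?_, ?_⟩
    · exact Finset.insert_subset hj ((Finset.erase_subset _ _).trans hsub)
    · rw [Finset.card_insert_of_notMem hjn', Finset.card_erase_add_one hi, hcard]
  have h1 := hmax _ hex
  rw [Finset.sum_insert hjn', ← Finset.add_sum_erase (sel v) v hi] at h1
  linarith

/-- The selection of the `min b |a|` elements of `a` with the largest scores `v`; ties are broken in
some measurable way. -/
noncomputable def topSet {m : ℕ} (b : ℕ) (a : Finset (Fin m)) : (Fin m → ℝ) → Finset (Fin m) :=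
  (exists_topSet b a).choose

lemma measurableSet_topSet_preimage {m : ℕ} (b : ℕ) (a T : Finset (Fin m)) :
    MeasurableSet (topSet b a ⁻¹' {T}) := (exists_topSet b a).choose_spec.1 T

lemma topSet_subset {m : ℕ} (b : ℕ) (a : Finset (Fin m)) (v : Fin m → ℝ) : topSet b a v ⊆ a :=
  ((exists_topSet b a).choose_spec.2 v).1

lemma card_topSet {m : ℕ} (b : ℕ) (a : Finset (Fin m)) (v : Fin m → ℝ) :
    (topSet b a v).card = min a.card b := ((exists_topSet b a).choose_spec.2 v).2.1

lemma le_of_mem_topSet {m : ℕ} {b : ℕ} {a : Finset (Fin m)} {v : Fin m → ℝ} {i j : Fin m}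
    (hi : i ∈ topSet b a v) (hj : j ∈ a) (hj' : j ∉ topSet b a v) : v j ≤ v i :=
  ((exists_topSet b a).choose_spec.2 v).2.2 i hi j hj hj'

/-- A best `s`-sparse approximation of a matrix can be chosen measurably: it suffices to select the
set of entries that are kept. -/
lemma exists_sparsify (n m s : ℕ) :
    ∃ trunc : Matrix (Fin n) (Fin m) ℝ → Matrix (Fin n) (Fin m) ℝ,
      (∀ i j, Measurable fun p : Fin n → Fin m → ℝ => trunc (Matrix.of p) i j) ∧
      (∀ A, IsSparseMatrix s (trunc A)) ∧ ∀ A, matrixL1 (A - trunc A) = sparseOpt s A := by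
  classical
  let keep : Finset (Fin n × Fin m) → Matrix (Fin n) (Fin m) ℝ → Matrix (Fin n) (Fin m) ℝ :=
    fun T A => Matrix.of fun i j => if (i, j) ∈ T then A i j else 0
  have hentry : ∀ i j, Measurable fun p : Fin n → Fin m → ℝ => p i j := fun i j =>
    (measurable_pi_apply j).comp (measurable_pi_apply i)
  have hkeep : ∀ T i j, Measurable fun p : Fin n → Fin m → ℝ => keep T (Matrix.of p) i j := by
    intro T i j
    by_cases h : (i, j) ∈ T
    · simpa [keep, h] using hentry i j
    · simp [keep, h]
  have hcost : ∀ T, Measurable fun p : Fin n → Fin m → ℝ =>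
      matrixL1 (Matrix.of p - keep T (Matrix.of p)) := by
    intro T
    unfold matrixL1
    refine Finset.measurable_sum _ fun j _ => Finset.measurable_sum _ fun i _ => ?_
    exact measurable_norm.comp ((hentry i j).sub (hkeep T i j))
  have hcount : ∀ T : Finset (Fin n × Fin m),
      (∑ j : Fin m, (Finset.univ.filter fun i => (i, j) ∈ T).card) = T.card := by
    intro T
    simp only [Finset.card_filter]
    rw [← Fintype.sum_prod_type_right (f := fun p : Fin n × Fin m => if p ∈ T then 1 else 0)]
    simp
  have hsp : ∀ T A, T.card ≤ s → IsSparseMatrix s (keep T A) := by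
    intro T A hT
    refine le_trans ?_ ((hcount T).le.trans hT)
    refine Finset.sum_le_sum fun j _ => Finset.card_le_card fun i hi => ?_
    simp only [Finset.mem_filter, Finset.mem_univ, true_and] at hi ⊢
    by_contra hiT
    exact hi (by simp [keep, hiT, Matrix.col])
  have hopt : ∀ A : Matrix (Fin n) (Fin m) ℝ, ∃ T : Finset (Fin n × Fin m), T.card ≤ s ∧
      matrixL1 (A - keep T A) = sparseOpt s A := by
    intro A
    obtain ⟨⟨B, hB, hBe⟩, hmin⟩ := isLeast_sparseOpt s A
    let T : Finset (Fin n × Fin m) := Finset.univ.filter fun p => B p.1 p.2 ≠ 0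
    have hT : T.card ≤ s := by
      rw [← hcount]
      refine le_trans (Finset.sum_le_sum fun j _ => Finset.card_le_card fun i hi => ?_) hB
      exact Finset.mem_filter.2 ⟨Finset.mem_univ i, by simpa [T] using hi⟩
    refine ⟨T, hT, le_antisymm ?_ (hmin ⟨_, hsp T A hT, rfl⟩)⟩
    rw [hBe]
    refine Finset.sum_le_sum fun j _ => Finset.sum_le_sum fun i _ => ?_
    by_cases h : B i j = 0 <;> simp [keep, T, h]
  obtain ⟨a, ham, haP⟩ := exists_measurable_choice
    (fun T : Finset (Fin n × Fin m) => {p : Fin n → Fin m → ℝ | T.card ≤ s ∧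
      ∀ T' : Finset (Fin n × Fin m), T'.card ≤ s →
        matrixL1 (Matrix.of p - keep T (Matrix.of p))
          ≤ matrixL1 (Matrix.of p - keep T' (Matrix.of p))})
    (fun T => by
      simp only [Set.ofPred_and, Set.ofPred_forall]
      exact (MeasurableSet.const _).inter (MeasurableSet.iInter fun T' =>
        MeasurableSet.iInter fun _ => measurableSet_le (hcost T) (hcost T')))
    (fun p => by
      obtain ⟨T, hT, hTe⟩ := hopt (Matrix.of p)
      refine ⟨T, hT, fun T' hT' => ?_⟩
      rw [hTe]
      exact (isLeast_sparseOpt s (Matrix.of p)).2 ⟨_, hsp T' _ hT', rfl⟩)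
  refine ⟨fun A => keep (a fun i j => A i j) A, fun i j => ?_, fun A => ?_, fun A => ?_⟩
  · exact measurable_of_measurable_choice (G := fun T p => keep T (Matrix.of p) i j) ham
      fun T => hkeep T i j
  · exact hsp _ A (haP _).1
  · obtain ⟨hs, hmin⟩ := haP fun i j => A i j
    obtain ⟨T, hT, hTe⟩ := hopt A
    refine le_antisymm ((hmin T hT).trans hTe.le) ?_
    exact (isLeast_sparseOpt s A).2 ⟨_, hsp _ A hs, rfl⟩

/-! ### The adaptive scheme -/

/-- The treatment of a column in one round: a sensing matrix, and, computed from its answers, an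
approximation of the column and an estimate of the error of this approximation. -/
structure ColumnSketch (n : ℕ) where
  /-- the number of measurements -/
  rows : ℕ
  /-- the sensing matrix -/
  mat : Matrix (Fin rows) (Fin n) ℝ
  /-- the approximation of the column -/
  dec : (Fin rows → ℝ) → Fin n → ℝ
  /-- the estimate of the `ℓ₁`-error of the approximation -/
  est : (Fin rows → ℝ) → ℝ
  measurable_dec : Measurable dec
  measurable_est : Measurable est

namespace ColumnSketch

variable {n : ℕ} (Q : ColumnSketch n)

/-- The approximation of the column `x`. -/
def recover (x : Fin n → ℝ) : Fin n → ℝ := Q.dec (Q.mat.mulVec x)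

/-- The estimated error of the approximation of the column `x`. -/
def estimate (x : Fin n → ℝ) : ℝ := Q.est (Q.mat.mulVec x)

lemma measurable_mulVec : Measurable Q.mat.mulVec :=
  (LinearMap.continuous_of_finiteDimensional Q.mat.mulVecLin).measurable

lemma measurable_recover : Measurable Q.recover := Q.measurable_dec.comp Q.measurable_mulVec

lemma measurable_estimate : Measurable Q.estimate := Q.measurable_est.comp Q.measurable_mulVec

end ColumnSketch

/-- The columns that are still active after a round: the `b` active ones with the largest estimated
errors. Inactive columns get the irrelevant score `0`. -/
noncomputable def nextActive {n m : ℕ} (Q : ColumnSketch n) (b : ℕ) (a : Finset (Fin m))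
    (A : Matrix (Fin n) (Fin m) ℝ) : Finset (Fin m) :=
  topSet b a fun j => if j ∈ a then Q.estimate (A.col j) else 0

/-- The approximation after a round: the active columns are replaced by their new
approximations. -/
def nextApprox {n m : ℕ} (Q : ColumnSketch n) (a : Finset (Fin m)) (X A : Matrix (Fin n) (Fin m) ℝ) :
    Matrix (Fin n) (Fin m) ℝ :=
  Matrix.of fun i j => if j ∈ a then Q.recover (A.col j) i else X i j

/-- The matrix `Φ` for an active column, and a matrix without rows for an inactive one. -/
def restrictRows {n t : ℕ} (Φ : Matrix (Fin t) (Fin n) ℝ) (p : Prop) [Decidable p] :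
    Matrix (Fin (if p then t else 0)) (Fin n) ℝ :=
  Φ.submatrix (Fin.castLE (by split_ifs <;> simp)) id

/-- The answers for a column as a vector of the full length `t`, filled up with zeros. -/
def padAnswers {t : ℕ} (p : Prop) [Decidable p] (y : Fin (if p then t else 0) → ℝ) : Fin t → ℝ :=
  fun i => if h : i.1 < (if p then t else 0) then y ⟨i.1, h⟩ else 0

lemma padAnswers_restrictRows_mulVec {n t : ℕ} (Φ : Matrix (Fin t) (Fin n) ℝ) {p : Prop}
    [Decidable p] (hp : p) (x : Fin n → ℝ) :
    padAnswers p ((restrictRows Φ p).mulVec x) = Φ.mulVec x := by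
  ext i
  have h : i.1 < (if p then t else 0) := by rw [if_pos hp]; exact i.2
  simp only [padAnswers, dif_pos h]
  rfl

/-- The adaptive scheme. In round `r` it applies the sketch `Q r` to the active columns `a`, updates
the current approximation `X` there, and keeps only the `b r` columns with the largest estimated
errors active. The post-processing `trunc` is applied to the last approximation.
The first argument is the number of remaining rounds. -/
noncomputable def peelingScheme {n m : ℕ} (Q : ℕ → ColumnSketch n) (b : ℕ → ℕ)
    (trunc : Matrix (Fin n) (Fin m) ℝ → Matrix (Fin n) (Fin m) ℝ) :
    ℕ → ℕ → Finset (Fin m) → Matrix (Fin n) (Fin m) ℝ → AdaptiveScheme n m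
  | 0, _, _, X => .done (trunc X)
  | l + 1, r, a, X => .round (fun j => if j ∈ a then (Q r).rows else 0)
      (fun j => restrictRows (Q r).mat (j ∈ a))
      fun y => peelingScheme Q b trunc l (r + 1)
        (topSet (b r) a fun j => if j ∈ a then (Q r).est (padAnswers (j ∈ a) (y j)) else 0)
        (Matrix.of fun i j => if j ∈ a then (Q r).dec (padAnswers (j ∈ a) (y j)) i else X i j)

section peelingScheme

variable {n m : ℕ} (Q : ℕ → ColumnSketch n) (b : ℕ → ℕ)
  (trunc : Matrix (Fin n) (Fin m) ℝ → Matrix (Fin n) (Fin m) ℝ)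

lemma peelingScheme_next (l r : ℕ) (a : Finset (Fin m)) (X A : Matrix (Fin n) (Fin m) ℝ) :
    peelingScheme Q b trunc l (r + 1)
        (topSet (b r) a fun j => if j ∈ a then
          (Q r).est (padAnswers (j ∈ a) ((restrictRows (Q r).mat (j ∈ a)).mulVec (A.col j))) else 0)
        (Matrix.of fun i j => if j ∈ a then
          (Q r).dec (padAnswers (j ∈ a) ((restrictRows (Q r).mat (j ∈ a)).mulVec (A.col j))) i
          else X i j)
      = peelingScheme Q b trunc l (r + 1) (nextActive (Q r) (b r) a A)
          (nextApprox (Q r) a X A) := by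
  congr 1
  · unfold nextActive ColumnSketch.estimate
    congr 1
    ext j
    split_ifs with hj
    · rw [padAnswers_restrictRows_mulVec _ hj]
    · rfl
  · unfold nextApprox ColumnSketch.recover
    congr 1
    ext i j
    split_ifs with hj
    · rw [padAnswers_restrictRows_mulVec _ hj]
    · rfl

lemma output_peelingScheme_succ (l r : ℕ) (a : Finset (Fin m)) (X A : Matrix (Fin n) (Fin m) ℝ) :
    (peelingScheme Q b trunc (l + 1) r a X).output A
      = (peelingScheme Q b trunc l (r + 1) (nextActive (Q r) (b r) a A)
          (nextApprox (Q r) a X A)).output A := by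
  rw [← peelingScheme_next]
  rfl

lemma rounds_peelingScheme (A : Matrix (Fin n) (Fin m) ℝ) :
    ∀ (l r : ℕ) (a : Finset (Fin m)) (X : Matrix (Fin n) (Fin m) ℝ),
      (peelingScheme Q b trunc l r a X).rounds A = l
  | 0, _, _, _ => rfl
  | l + 1, r, a, X => by
    rw [peelingScheme, AdaptiveScheme.rounds, rounds_peelingScheme A l, add_comm]

/-- If at most `N r` columns are active in round `r`, the number of measurements is at most
`∑ r, N r * rows r`. -/
lemma measurements_peelingScheme_le (A : Matrix (Fin n) (Fin m) ℝ) (N : ℕ → ℕ)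
    (hN : ∀ r, b r ≤ N (r + 1)) :
    ∀ (l r : ℕ) (a : Finset (Fin m)) (X : Matrix (Fin n) (Fin m) ℝ), a.card ≤ N r →
      (peelingScheme Q b trunc l r a X).measurements A
        ≤ ∑ i ∈ Finset.range l, N (r + i) * (Q (r + i)).rows
  | 0, _, _, _, _ => by simp [peelingScheme, AdaptiveScheme.measurements]
  | l + 1, r, a, X, ha => by
    rw [peelingScheme, AdaptiveScheme.measurements, Finset.sum_range_succ', add_comm]
    refine Nat.add_le_add ?_ ?_
    · refine (measurements_peelingScheme_le A N hN l (r + 1) _ _ ?_).trans (le_of_eq ?_)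
      · rw [card_topSet]
        exact (min_le_right _ _).trans (hN r)
      · exact Finset.sum_congr rfl fun i _ => by rw [add_assoc, add_comm 1]
    · simpa using Nat.mul_le_mul_right (Q r).rows ha

lemma exists_output_peelingScheme_eq_trunc (A : Matrix (Fin n) (Fin m) ℝ) :
    ∀ (l r : ℕ) (a : Finset (Fin m)) (X : Matrix (Fin n) (Fin m) ℝ),
      ∃ Y, (peelingScheme Q b trunc l r a X).output A = trunc Y
  | 0, _, _, X => ⟨X, rfl⟩
  | l + 1, r, a, X => by
    rw [output_peelingScheme_succ]
    exact exists_output_peelingScheme_eq_trunc A l _ _ _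

lemma measurable_output_peelingScheme
    (htrunc : ∀ i j, Measurable fun p : Fin n → Fin m → ℝ => trunc (Matrix.of p) i j)
    (i : Fin n) (j : Fin m) :
    ∀ (l r : ℕ) (a : Finset (Fin m)),
      Measurable fun p : (Fin n → Fin m → ℝ) × (Fin n → Fin m → ℝ) =>
        (peelingScheme Q b trunc l r a (Matrix.of p.1)).output (Matrix.of p.2) i j
  | 0, _, _ => (htrunc i j).comp measurable_fst
  | l + 1, r, a => by
    have hcol : ∀ j, Measurable fun p : (Fin n → Fin m → ℝ) × (Fin n → Fin m → ℝ) =>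
        (Matrix.of p.2).col j := fun j => measurable_pi_lambda _ fun i =>
      (measurable_pi_apply j).comp ((measurable_pi_apply i).comp measurable_snd)
    have hact : ∀ T, MeasurableSet ((fun p : (Fin n → Fin m → ℝ) × (Fin n → Fin m → ℝ) =>
        nextActive (Q r) (b r) a (Matrix.of p.2)) ⁻¹' {T}) := by
      intro T
      refine (measurable_pi_lambda _ fun j => ?_ : Measurable fun
        p : (Fin n → Fin m → ℝ) × (Fin n → Fin m → ℝ) => fun j : Fin m =>
          if j ∈ a then (Q r).estimate ((Matrix.of p.2).col j) else 0)
        (measurableSet_topSet_preimage (b r) a T)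
      split_ifs
      · exact (Q r).measurable_estimate.comp (hcol j)
      · exact measurable_const
    have happ : Measurable fun p : (Fin n → Fin m → ℝ) × (Fin n → Fin m → ℝ) =>
        ((fun i j => nextApprox (Q r) a (Matrix.of p.1) (Matrix.of p.2) i j, p.2) :
          (Fin n → Fin m → ℝ) × (Fin n → Fin m → ℝ)) := by
      refine Measurable.prodMk (measurable_pi_lambda _ fun i => measurable_pi_lambda _ fun j => ?_)
        measurable_snd
      simp only [nextApprox, Matrix.of_apply]
      split_ifs
      · exact (measurable_pi_apply i).comp ((Q r).measurable_recover.comp (hcol j))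
      · exact (measurable_pi_apply j).comp ((measurable_pi_apply i).comp measurable_fst)
    have h := measurable_of_measurable_choice hact (G := fun T p =>
      (peelingScheme Q b trunc l (r + 1) T
        (nextApprox (Q r) a (Matrix.of p.1) (Matrix.of p.2))).output (Matrix.of p.2) i j)
      fun T => (measurable_output_peelingScheme htrunc i j l (r + 1) T).comp happ
    simpa only [output_peelingScheme_succ] using h

/-! ### The approximation guarantee -/

/-- A column that is dropped in round `r` has small error. Here `w j` is the sparsity and `e j` the
error of the `j`-th column of a competing approximation. This is clear if `w j ≤ k 2 ^ r`. At most
`M = ⌊m / 2 ^ r⌋` columns violate this bound, so of the `2 M` columns that stay active, at least `M`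
satisfy it; their estimated errors are at least that of the column `j`, hence the error of the
column `j` is `O(∑ e / M)`. As `M` is about `m / 2 ^ r`, this is at most the share of the column in
`O(∑ e)` if the columns are weighted by `w`. -/
lemma error_le_of_dropped {k r : ℕ} (hk : 1 ≤ k) (S : ColumnSketch n)
    (a : Finset (Fin m)) (A : Matrix (Fin n) (Fin m) ℝ) (w : Fin m → ℕ) (e : Fin m → ℝ)
    (he : ∀ j, 0 ≤ e j) (hw : ∑ j, w j ≤ k * m)
    (hrec : ∀ j, w j ≤ k * 2 ^ r → vecL1 (A.col j - S.recover (A.col j)) ≤ 7 * e j)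
    (hest : ∀ j, vecL1 (A.col j - S.recover (A.col j)) / 10 ≤ S.estimate (A.col j) ∧
      S.estimate (A.col j) ≤ 80 * vecL1 (A.col j - S.recover (A.col j)))
    {j : Fin m} (hj : j ∈ a) (hdrop : j ∉ nextActive S (2 * (m / 2 ^ r)) a A) :
    vecL1 (A.col j - S.recover (A.col j)) ≤ 7 * e j + 11200 * (∑ i, e i) * (w j / (k * m)) := by
  classical
  have hE : 0 ≤ ∑ i, e i := Finset.sum_nonneg fun i _ => he i
  by_cases hgood : w j ≤ k * 2 ^ r
  · refine (hrec j hgood).trans (le_add_of_nonneg_right ?_)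
    positivity
  set M := m / 2 ^ r with hM
  set bad := Finset.univ.filter fun j => ¬ w j ≤ k * 2 ^ r with hbad
  have hjbad : j ∈ bad := by simpa [hbad] using hgood
  have hpow : 0 < 2 ^ r := by positivity
  have hbadM : bad.card ≤ M := by
    rw [hM, Nat.le_div_iff_mul_le hpow]
    have h1 : bad.card * (k * 2 ^ r) ≤ ∑ j, w j := by
      rw [← smul_eq_mul, ← Finset.sum_const]
      refine (Finset.sum_le_sum fun i hi => ?_).trans
        (Finset.sum_le_sum_of_subset (Finset.subset_univ bad))
      exact (not_le.1 (Finset.mem_filter.1 hi).2).le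
    have h2 : k * (bad.card * 2 ^ r) ≤ k * m := by
      calc k * (bad.card * 2 ^ r) = bad.card * (k * 2 ^ r) := by ring
        _ ≤ _ := h1.trans hw
    exact Nat.le_of_mul_le_mul_left h2 hk
  have hM1 : 1 ≤ M := (Finset.card_pos.2 ⟨j, hjbad⟩ : 0 < bad.card).trans_le hbadM
  set T := nextActive S (2 * M) a A with hT
  have hTa : T ⊆ a := topSet_subset _ _ _
  have hTcard : T.card = 2 * M := by
    have h1 : T.card = min a.card (2 * M) := card_topSet _ _ _
    rcases le_total a.card (2 * M) with h | h
    · rw [min_eq_left h] at h1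
      exact absurd (Finset.eq_of_subset_of_card_le hTa h1.ge ▸ hj) hdrop
    · rw [h1, min_eq_right h]
  set G := T \ bad with hG
  have hGcard : M ≤ G.card := by
    have : T.card - bad.card ≤ G.card := Finset.le_card_sdiff bad T
    omega
  set ρ := vecL1 (A.col j - S.recover (A.col j)) with hρ
  have hGle : ∀ i ∈ G, ρ ≤ 5600 * e i := by
    intro i hi
    obtain ⟨hiT, hib⟩ := Finset.mem_sdiff.1 hi
    have h1 := le_of_mem_topSet hiT hj hdrop
    simp only [if_pos hj, if_pos (hTa hiT)] at h1
    have h2 := hrec i (by simpa [hbad] using hib)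
    linarith [(hest j).1, (hest i).2]
  have hMρ : M * ρ ≤ 5600 * ∑ i, e i := by
    calc (M : ℝ) * ρ ≤ G.card * ρ := by
          have : 0 ≤ ρ := vecL1_nonneg _
          gcongr
      _ = ∑ i ∈ G, ρ := by rw [Finset.sum_const, nsmul_eq_mul]
      _ ≤ ∑ i ∈ G, 5600 * e i := Finset.sum_le_sum hGle
      _ ≤ ∑ i, 5600 * e i := Finset.sum_le_sum_of_subset_of_nonneg (Finset.subset_univ _)
          fun i _ _ => mul_nonneg (by norm_num) (he i)
      _ = _ := by rw [Finset.mul_sum]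
  have hmM : (m : ℝ) ≤ 2 * M * 2 ^ r := by
    have h1 : m < 2 ^ r * (M + 1) := Nat.lt_mul_div_succ m hpow
    have h2 : 2 ^ r * (M + 1) ≤ 2 * M * 2 ^ r := by nlinarith
    exact_mod_cast h1.le.trans h2
  have hwj : (k : ℝ) * 2 ^ r ≤ w j := by exact_mod_cast (not_le.1 hgood).le
  have hm : (0 : ℝ) < m := by exact_mod_cast (Fin.pos j)
  have hk' : (0 : ℝ) < k := by exact_mod_cast hk
  have hM' : (0 : ℝ) < M := by exact_mod_cast hM1
  refine le_add_of_nonneg_of_le (mul_nonneg (by norm_num) (he j)) ?_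
  refine le_of_mul_le_mul_left (hMρ.trans ?_) hM'
  have hshare : (1 : ℝ) ≤ M * (2 * (w j / (k * m))) := by
    rw [← mul_div_assoc, ← mul_div_assoc, le_div_iff₀ (by positivity), one_mul]
    calc (k : ℝ) * m ≤ k * (2 * M * 2 ^ r) := by gcongr
      _ = M * (2 * (k * 2 ^ r)) := by ring
      _ ≤ M * (2 * w j) := by gcongr
  calc 5600 * ∑ i, e i = 5600 * (∑ i, e i) * 1 := (mul_one _).symm
    _ ≤ 5600 * (∑ i, e i) * (M * (2 * (w j / (k * m)))) := by gcongr
    _ = _ := by ring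

/-- The approximation before the post-processing has small error in every column, provided that no
column is active at the end. -/
lemma exists_output_peelingScheme_error_le {k R : ℕ} (hk : 1 ≤ k)
    (A : Matrix (Fin n) (Fin m) ℝ) (w : Fin m → ℕ) (e : Fin m → ℝ)
    (he : ∀ j, 0 ≤ e j) (hw : ∑ j, w j ≤ k * m)
    (hrec : ∀ r j, w j ≤ k * 2 ^ r →
      vecL1 (A.col j - (Q r).recover (A.col j)) ≤ 7 * e j)
    (hest : ∀ r < R, ∀ j, vecL1 (A.col j - (Q r).recover (A.col j)) / 10
        ≤ (Q r).estimate (A.col j) ∧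
      (Q r).estimate (A.col j) ≤ 80 * vecL1 (A.col j - (Q r).recover (A.col j)))
    (hend : m < 2 ^ (R - 1)) :
    ∀ (l r : ℕ), r + l = R → ∀ (a : Finset (Fin m)) (X : Matrix (Fin n) (Fin m) ℝ),
      (l = 0 → a = ∅) →
      (∀ j ∉ a, vecL1 (A.col j - X.col j)
        ≤ 7 * e j + 11200 * (∑ i, e i) * (w j / (k * m))) →
      ∃ Y, (peelingScheme Q (fun r => 2 * (m / 2 ^ r)) trunc l r a X).output A = trunc Y ∧
        ∀ j, vecL1 (A.col j - Y.col j) ≤ 7 * e j + 11200 * (∑ i, e i) * (w j / (k * m))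
  | 0, r, _, a, X, h0, hX =>
    ⟨X, rfl, fun j => hX j (by rw [h0 rfl]; exact Finset.notMem_empty j)⟩
  | l + 1, r, hr, a, X, _, hX => by
    rw [output_peelingScheme_succ]
    refine exists_output_peelingScheme_error_le hk A w e he hw hrec hest hend l (r + 1) (by omega)
      _ _ (fun hl => ?_) fun j hj => ?_
    · have h1 : (nextActive (Q r) (2 * (m / 2 ^ r)) a A).card ≤ 2 * (m / 2 ^ r) :=
        (card_topSet _ _ _).trans_le (min_le_right _ _)
      rw [show r = R - 1 by omega, Nat.div_eq_of_lt hend] at h1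
      rw [show r = R - 1 by omega, Nat.div_eq_of_lt hend]
      exact Finset.card_eq_zero.1 (Nat.le_zero.1 h1)
    · by_cases hja : j ∈ a
      · have hcol : (nextApprox (Q r) a X A).col j = (Q r).recover (A.col j) := by
          ext i
          simp [nextApprox, Matrix.col, hja]
        rw [hcol]
        exact error_le_of_dropped hk (Q r) a A w e he hw (hrec r) (hest r (by omega)) hja hj
      · have hcol : (nextApprox (Q r) a X A).col j = X.col j := by
          ext i
          simp [nextApprox, Matrix.col, hja]
        rw [hcol]
        exact hX j hja

end peelingScheme

/-! ### Assembling the scheme -/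

/-- Sparse recovery together with an estimate of its error: next to the answers to `S`, from which
the approximation `z` of the column `x` is decoded, the answers to the random functionals `F` are
received, and `F x - F z` is a sketch of the error. -/
noncomputable def recoverySketch {n t s : ℕ} (S : Matrix (Fin t) (Fin n) ℝ)
    (dec : (Fin t → ℝ) → Fin n → ℝ) (hdec : Measurable dec)
    (F : Matrix (Fin (4 * s)) (Fin n) ℝ) (hs : 1 ≤ s) : ColumnSketch n where
  rows := t + 4 * s
  mat := Matrix.of (Fin.append S F)
  dec y := dec fun i => y (Fin.castAdd (4 * s) i)
  est y := kthLargest s hs (by omega) ((fun l => y (Fin.natAdd t l)) -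
    F.mulVec (dec fun i => y (Fin.castAdd (4 * s) i)))
  measurable_dec := hdec.comp (measurable_pi_lambda _ fun _ => measurable_pi_apply _)
  measurable_est := by
    refine (continuous_kthLargest s hs (by omega)).measurable.comp (Measurable.sub ?_ ?_)
    · exact measurable_pi_lambda _ fun _ => measurable_pi_apply _
    · exact (LinearMap.continuous_of_finiteDimensional F.mulVecLin).measurable.comp
        (hdec.comp (measurable_pi_lambda _ fun _ => measurable_pi_apply _))

section recoverySketch

variable {n t s : ℕ} (S : Matrix (Fin t) (Fin n) ℝ) (dec : (Fin t → ℝ) → Fin n → ℝ)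
  (hdec : Measurable dec) (F : Matrix (Fin (4 * s)) (Fin n) ℝ) (hs : 1 ≤ s)

lemma append_mulVec_castAdd (x : Fin n → ℝ) :
    (fun i => (Matrix.of (Fin.append S F)).mulVec x (Fin.castAdd (4 * s) i)) = S.mulVec x :=
  funext fun i => congrArg (· ⬝ᵥ x) (Fin.append_left S F i)

lemma append_mulVec_natAdd (x : Fin n → ℝ) :
    (fun l => (Matrix.of (Fin.append S F)).mulVec x (Fin.natAdd t l)) = F.mulVec x :=
  funext fun l => congrArg (· ⬝ᵥ x) (Fin.append_right S F l)

lemma recover_recoverySketch (x : Fin n → ℝ) :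
    (recoverySketch S dec hdec F hs).recover x = dec (S.mulVec x) :=
  congrArg dec (append_mulVec_castAdd S F x)

lemma estimate_recoverySketch (hs4 : s ≤ 4 * s) (x : Fin n → ℝ) :
    (recoverySketch S dec hdec F hs).estimate x
      = kthLargest s hs hs4 (F.mulVec (x - dec (S.mulVec x))) := by
  rw [Matrix.mulVec_sub, ← append_mulVec_castAdd S F x, ← append_mulVec_natAdd S F x]
  rfl

end recoverySketch

lemma matrixL1_eq_sum_vecL1 {n m : ℕ} (A : Matrix (Fin n) (Fin m) ℝ) :
    matrixL1 A = ∑ j, vecL1 (A.col j) := rfl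

lemma matrixL1_sub_le {n m : ℕ} (A B D : Matrix (Fin n) (Fin m) ℝ) :
    matrixL1 (A - D) ≤ matrixL1 (A - B) + matrixL1 (B - D) := by
  simp only [matrixL1_eq_sum_vecL1]
  rw [← Finset.sum_add_distrib]
  exact Finset.sum_le_sum fun j _ => vecL1_sub_le (A.col j) (B.col j) (D.col j)

lemma matrixL1_sub_comm {n m : ℕ} (A B : Matrix (Fin n) (Fin m) ℝ) :
    matrixL1 (A - B) = matrixL1 (B - A) := by
  simp only [matrixL1_eq_sum_vecL1]
  exact Finset.sum_congr rfl fun j _ => vecL1_sub_comm (A.col j) (B.col j)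

/-- For fixed sensing matrices, with accurate estimates of the errors of all approximations, the
scheme is accurate. The post-processing replaces the approximation `Y` by a best sparse
approximation of `Y`, whose distance from `Y` is at most that of an optimal approximation of `A`. -/
lemma matrixL1_sub_output_peelingScheme_le {n m k R : ℕ} (hk : 1 ≤ k) (hR : m < 2 ^ (R - 1))
    (hR1 : 1 ≤ R) (Q : ℕ → ColumnSketch n)
    (trunc : Matrix (Fin n) (Fin m) ℝ → Matrix (Fin n) (Fin m) ℝ)
    (htrunc : ∀ A, matrixL1 (A - trunc A) = sparseOpt (k * m) A)
    (A : Matrix (Fin n) (Fin m) ℝ)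
    (hrec : ∀ r x w, hammingNorm w ≤ k * 2 ^ r → vecL1 (x - (Q r).recover x) ≤ 7 * vecL1 (x - w))
    (hest : ∀ r < R, ∀ j, vecL1 (A.col j - (Q r).recover (A.col j)) / 10
        ≤ (Q r).estimate (A.col j) ∧
      (Q r).estimate (A.col j) ≤ 80 * vecL1 (A.col j - (Q r).recover (A.col j))) :
    matrixL1 (A - (peelingScheme Q (fun r => 2 * (m / 2 ^ r)) trunc R 0 Finset.univ 0).output A)
      ≤ 22415 * sparseOpt (k * m) A := by
  obtain ⟨⟨B, hB, hBe⟩, -⟩ := isLeast_sparseOpt (k * m) A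
  set w : Fin m → ℕ := fun j => hammingNorm (B.col j) with hw
  set e : Fin m → ℝ := fun j => vecL1 (A.col j - B.col j) with he
  have hsum : ∑ j, e j = sparseOpt (k * m) A := by rw [hBe]; rfl
  have hopt : 0 ≤ sparseOpt (k * m) A := by
    rw [← hsum]
    exact Finset.sum_nonneg fun j _ => vecL1_nonneg _
  obtain ⟨Y, hY, hYe⟩ := exists_output_peelingScheme_error_le Q trunc hk A w e
    (fun j => vecL1_nonneg _) hB (fun r j => hrec r (A.col j) (B.col j)) hest hR R 0 (by omega)
    Finset.univ 0 (fun h => by omega) (fun j hj => absurd (Finset.mem_univ j) hj)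
  have hAY : matrixL1 (A - Y) ≤ 11207 * sparseOpt (k * m) A := by
    have hshare : ∑ j, (w j : ℝ) / (k * m) ≤ 1 := by
      rw [← Finset.sum_div]
      refine div_le_one_of_le₀ ?_ (by positivity)
      exact_mod_cast hB
    have h1 : matrixL1 (A - Y) ≤ ∑ j, (7 * e j + 11200 * (∑ i, e i) * (w j / (k * m))) :=
      Finset.sum_le_sum fun j _ => hYe j
    rw [Finset.sum_add_distrib, ← Finset.mul_sum, ← Finset.mul_sum, hsum] at h1
    nlinarith
  rw [hY]
  have h1 := matrixL1_sub_le A Y (trunc Y)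
  have h2 : matrixL1 (Y - trunc Y) ≤ matrixL1 (Y - B) := by
    rw [htrunc]
    exact (isLeast_sparseOpt (k * m) Y).2 ⟨B, hB, rfl⟩
  have h3 := matrixL1_sub_le Y A B
  rw [matrixL1_sub_comm Y A, ← hBe] at h3
  linarith

/-- The total number of measurements: every round costs `O(k m d)` for the sparse recovery, as the
number of active columns halves when the sparsity doubles, and the costs of the error estimates form
a geometric series. -/
lemma sum_measurements_le (m k d s R : ℕ) :
    ((∑ r ∈ Finset.range R, (if r = 0 then m else 2 * (m / 2 ^ (r - 1))) *
        (d * (4096 * (2 * (k * 2 ^ r))) + 4 * s) : ℕ) : ℝ)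
      ≤ 32768 * (k * m * d * R) + 32 * (m * s) := by
  push_cast
  set N : ℕ → ℝ := fun r => if r = 0 then (m : ℝ) else 2 * ((m / 2 ^ (r - 1) : ℕ) : ℝ) with hN
  have hN4 : ∀ r, N r ≤ 4 * m * (1 / 2) ^ r := by
    intro r
    rcases r with _ | r
    · simp only [hN, if_true, pow_zero]
      have : (0 : ℝ) ≤ m := Nat.cast_nonneg m
      linarith
    · have h : ((m / 2 ^ r : ℕ) : ℝ) ≤ m / 2 ^ r := by
        have := Nat.cast_div_le (α := ℝ) (m := m) (n := 2 ^ r)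
        simpa using this
      simp only [hN, Nat.succ_ne_zero, if_false, Nat.add_sub_cancel]
      calc 2 * ((m / 2 ^ r : ℕ) : ℝ) ≤ 2 * (m / 2 ^ r) := by gcongr
        _ = _ := by rw [pow_succ, one_div, inv_pow]; ring
  have hterm : ∀ r, N r * (d * (4096 * (2 * (k * 2 ^ r))) + 4 * s)
      ≤ 32768 * (k * m * d) + 16 * (m * s) * (1 / 2) ^ r := by
    intro r
    have h2 : ((1 : ℝ) / 2) ^ r * 2 ^ r = 1 := by rw [← mul_pow]; norm_num
    calc N r * (d * (4096 * (2 * (k * 2 ^ r))) + 4 * s)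
        ≤ 4 * m * (1 / 2) ^ r * (d * (4096 * (2 * (k * 2 ^ r))) + 4 * s) := by
          gcongr
          exact hN4 r
      _ = 32768 * (k * m * d) * ((1 / 2) ^ r * 2 ^ r) + 16 * (m * s) * (1 / 2) ^ r := by ring
      _ = _ := by rw [h2, mul_one]
  refine (Finset.sum_le_sum fun r _ => ?_).trans
    ((Finset.sum_le_sum fun r (_ : r ∈ Finset.range R) => hterm r).trans ?_)
  · simp only [hN]
    exact le_rfl
  · rw [Finset.sum_add_distrib, Finset.sum_const, Finset.card_range, nsmul_eq_mul,
      ← Finset.mul_sum]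
    have h := sum_geometric_two_le R
    have : (0 : ℝ) ≤ 16 * (m * s) := by positivity
    nlinarith

/-- The randomized scheme with a uniformly random seed from a finite set. -/
noncomputable def uniformScheme {n m : ℕ} (Ω : Type) [Fintype Ω] [Nonempty Ω]
    (scheme : Ω → AdaptiveScheme n m)
    (hmeas : ∀ ω i j, Measurable fun p : Fin n → Fin m → ℝ =>
      (scheme ω).output (Matrix.of p) i j) : RandomizedScheme n m :=
  letI : MeasurableSpace Ω := ⊤
  { Seed := Ω
    law := (PMF.uniformOfFintype Ω).toMeasure
    scheme := scheme
    measurable_output := fun i j => measurable_from_prod_countable_right fun ω => hmeas ω i j }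

/-- Union bound for a uniformly random seed, in terms of counts. -/
lemma one_sub_le_uniformScheme_law_real {n m : ℕ} {Ω : Type} [Fintype Ω] [Nonempty Ω]
    (scheme : Ω → AdaptiveScheme n m)
    (hmeas : ∀ ω i j, Measurable fun p : Fin n → Fin m → ℝ =>
      (scheme ω).output (Matrix.of p) i j)
    {ι : Type*} (I : Finset ι) (good : ι → Ω → Prop) (p δ : ℝ)
    [∀ i, DecidablePred (good i)]
    (hgood : ∀ i ∈ I, ((Finset.univ.filter fun ω => ¬ good i ω).card : ℝ) ≤ p * Fintype.card Ω)
    (hp : I.card * p ≤ δ) (E : Set Ω) (hE : ∀ ω, (∀ i ∈ I, good i ω) → ω ∈ E) :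
    1 - δ ≤ (uniformScheme Ω scheme hmeas).law.real E := by
  classical
  have hcard : (0 : ℝ) < Fintype.card Ω := by exact_mod_cast Fintype.card_pos
  let : MeasurableSpace Ω := ⊤
  have hreal : (uniformScheme Ω scheme hmeas).law.real E
      = ((Finset.univ.filter fun ω => ω ∈ E).card : ℝ) / Fintype.card Ω := by
    change (PMF.uniformOfFintype Ω).toMeasure.real E = _
    rw [Measure.real, PMF.toMeasure_uniformOfFintype_apply _ (Set.toFinite E).measurableSet,
      ENNReal.toReal_div, ENNReal.toReal_natCast, ENNReal.toReal_natCast]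
    congr 2
    exact Fintype.card_subtype _
  have hbad : ((Finset.univ.filter fun ω => ω ∉ E).card : ℝ) ≤ δ * Fintype.card Ω := by
    have hsub : (Finset.univ.filter fun ω => ω ∉ E) ⊆
        I.biUnion fun i => Finset.univ.filter fun ω => ¬ good i ω := by
      intro ω hω
      have hω : ω ∉ E := (Finset.mem_filter.1 hω).2
      by_contra hcon
      refine hω (hE ω fun i hi => ?_)
      by_contra hi'
      exact hcon (Finset.mem_biUnion.2 ⟨i, hi, Finset.mem_filter.2 ⟨Finset.mem_univ _, hi'⟩⟩)
    calc ((Finset.univ.filter fun ω => ω ∉ E).card : ℝ)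
        ≤ ∑ i ∈ I, ((Finset.univ.filter fun ω => ¬ good i ω).card : ℝ) := by
          exact_mod_cast (Finset.card_le_card hsub).trans Finset.card_biUnion_le
      _ ≤ ∑ i ∈ I, p * Fintype.card Ω := Finset.sum_le_sum hgood
      _ = (I.card * p) * Fintype.card Ω := by rw [Finset.sum_const, nsmul_eq_mul]; ring
      _ ≤ δ * Fintype.card Ω := by gcongr
  have hsplit := Finset.card_filter_add_card_filter_not (s := (Finset.univ : Finset Ω))
    (p := fun ω => ω ∈ E)
  have hsplit' : ((Finset.univ.filter fun ω => ω ∈ E).card : ℝ)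
      + ((Finset.univ.filter fun ω => ω ∉ E).card : ℝ) = Fintype.card Ω := by
    exact_mod_cast hsplit
  rw [hreal, le_div_iff₀ hcard]
  linarith

/-- With `s = O(log n + log m)` functionals per column and round, a union bound over all columns and
rounds leaves a failure probability of at most `n ^ (-c)`. -/
lemma exists_repetitions (c : ℝ) (hc : 0 < c) :
    ∃ K : ℝ, 0 < K ∧ ∀ n m : ℕ, 1 ≤ n → 1 ≤ m → ∃ s : ℕ, 1 ≤ s ∧
      4 * (m : ℝ) ^ 2 * (3 / 4) ^ s ≤ (n : ℝ) ^ (-c) ∧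
      (s : ℝ) ≤ K * (Real.log (2 * n) * Real.log (2 * m)) := by
  set g := Real.log (4 / 3) with hg
  have hgpos : 0 < g := Real.log_pos (by norm_num)
  have h2 : 0 < Real.log 2 := Real.log_pos (by norm_num)
  refine ⟨(c + 2) / g / Real.log 2 + 1 / (Real.log 2 * Real.log 2), by positivity, ?_⟩
  intro n m hn hm
  have hn' : (1 : ℝ) ≤ n := by exact_mod_cast hn
  have hm' : (1 : ℝ) ≤ m := by exact_mod_cast hm
  set x := Real.log (2 * n) with hx
  set y := Real.log (2 * m) with hy
  have hx2 : Real.log 2 ≤ x := Real.log_le_log (by norm_num) (by linarith)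
  have hy2 : Real.log 2 ≤ y := Real.log_le_log (by norm_num) (by linarith)
  have hxpos : 0 < x := h2.trans_le hx2
  have hypos : 0 < y := h2.trans_le hy2
  have hlogn : Real.log n ≤ x := Real.log_le_log (by linarith) (by linarith)
  have hlogn0 : 0 ≤ Real.log n := Real.log_nonneg hn'
  set v := (c * Real.log n + 2 * y) / g with hv
  have hvpos : 0 < v := by positivity
  refine ⟨⌈v⌉₊, Nat.ceil_pos.2 hvpos, ?_, ?_⟩
  · have hsv : c * Real.log n + 2 * y ≤ ⌈v⌉₊ * g := by
      have := Nat.le_ceil v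
      rw [hv, div_le_iff₀ hgpos] at this
      exact this
    have h34 : (3 / 4 : ℝ) ^ ⌈v⌉₊ = Real.exp (-(⌈v⌉₊ * g)) := by
      rw [hg, ← mul_neg, ← Real.log_inv, Real.exp_nat_mul, Real.exp_log (by norm_num)]
      norm_num
    have h4m : 4 * (m : ℝ) ^ 2 = Real.exp (2 * y) := by
      rw [two_mul y, Real.exp_add, hy, Real.exp_log (by positivity)]
      ring
    rw [h34, h4m, ← Real.exp_add, Real.rpow_def_of_pos (by linarith)]
    exact Real.exp_le_exp.2 (by linarith)
  · have h1 : (⌈v⌉₊ : ℝ) ≤ v + 1 := (Nat.ceil_lt_add_one hvpos.le).le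
    have hxy1 : x ≤ x * y / Real.log 2 := by
      rw [le_div_iff₀ h2]
      gcongr
    have hxy2 : y ≤ x * y / Real.log 2 := by
      rw [le_div_iff₀ h2, mul_comm]
      gcongr
    have hxy3 : 1 ≤ x * y / (Real.log 2 * Real.log 2) := by
      rw [le_div_iff₀ (by positivity), one_mul]
      gcongr
    have hv2 : v ≤ (c + 2) * (x * y / Real.log 2) / g := by
      rw [hv]
      gcongr
      nlinarith
    calc (⌈v⌉₊ : ℝ) ≤ v + 1 := h1
      _ ≤ (c + 2) * (x * y / Real.log 2) / g + x * y / (Real.log 2 * Real.log 2) := by linarith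
      _ = _ := by ring

/-- The scheme with its parameters: `d` hash functions, `4 s` random functionals and `R` rounds. -/
lemma exists_randomizedScheme {n m k d s R : ℕ} (hk : 1 ≤ k) (hkn : k ≤ n) (hd1 : 1 ≤ d)
    (hd4 : 2 * n ≤ 4 ^ d) (hs : 1 ≤ s) (hR1 : 1 ≤ R) (hmR : m < 2 ^ (R - 1)) :
    ∃ P : RandomizedScheme n m, ∀ A : Matrix (Fin n) (Fin m) ℝ,
      1 - (R * m : ℕ) * (2 * (3 / 4) ^ s) ≤
        P.law.real {ω | matrixL1 (A - (P.scheme ω).output A) ≤ 22415 * sparseOpt (k * m) A} ∧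
      ∀ ω : P.Seed,
        IsSparseMatrix (k * m) ((P.scheme ω).output A) ∧
        ((P.scheme ω).measurements A : ℝ) ≤ 32768 * (k * m * d * R) + 32 * (m * s) ∧
        (P.scheme ω).rounds A = R := by
  classical
  have hs4 : s ≤ 4 * s := by omega
  have hex := fun r : ℕ => exists_sparse_recovery n d (k * 2 ^ r)
    (Nat.mul_pos hk (by positivity)) hd1 hd4
  choose S dec hdec hrec using hex
  obtain ⟨trunc, htm, hts, hto⟩ := exists_sparsify n m (k * m)
  have : Nonempty (Fin n) := ⟨⟨0, hk.trans hkn⟩⟩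
  let Q : (Fin (4 * s) → FunctionalSeed n) → ℕ → ColumnSketch n := fun ω r =>
    recoverySketch (S r) (dec r) (hdec r) (randomSketch ω) hs
  let scheme : (Fin (4 * s) → FunctionalSeed n) → AdaptiveScheme n m := fun ω =>
    peelingScheme (Q ω) (fun r => 2 * (m / 2 ^ r)) trunc R 0 Finset.univ 0
  have hmeas : ∀ ω i j, Measurable fun p : Fin n → Fin m → ℝ =>
      (scheme ω).output (Matrix.of p) i j := fun ω i j =>
    (measurable_output_peelingScheme (Q ω) _ trunc htm i j R 0 Finset.univ).comp
      (measurable_const.prodMk measurable_id)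
  refine ⟨uniformScheme _ scheme hmeas, fun A => ⟨?_, fun ω => ?_⟩⟩
  · -- union bound over the errors of all columns in all rounds, which do not depend on the seed
    let res : ℕ × Fin m → Fin n → ℝ := fun p =>
      A.col p.2 - dec p.1 ((S p.1).mulVec (A.col p.2))
    refine one_sub_le_uniformScheme_law_real scheme hmeas (Finset.range R ×ˢ Finset.univ)
      (fun p ω => vecL1 (res p) / 10 ≤ kthLargest s hs hs4 ((randomSketch ω).mulVec (res p)) ∧
          kthLargest s hs hs4 ((randomSketch ω).mulVec (res p)) ≤ 80 * vecL1 (res p))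
      (2 * (3 / 4) ^ s) _ (fun p _ => ?_) ?_ _ fun ω hω => ?_
    · convert card_kthLargest_randomSketch_le hs hs4 (res p)
    · rw [Finset.card_product, Finset.card_range, Finset.card_univ, Fintype.card_fin]
    · refine matrixL1_sub_output_peelingScheme_le hk hmR hR1 (Q ω) trunc hto A
        (fun r x w hw => ?_) fun r hr j => ?_
      · rw [recover_recoverySketch]
        exact hrec r x w hw
      · rw [recover_recoverySketch, estimate_recoverySketch _ _ _ _ _ hs4]
        exact hω (r, j) (by simp [hr])
  · change IsSparseMatrix (k * m) ((scheme ω).output A) ∧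
      ((scheme ω).measurements A : ℝ) ≤ _ ∧ (scheme ω).rounds A = R
    refine ⟨?_, ?_, rounds_peelingScheme ..⟩
    · obtain ⟨Y, hY⟩ := exists_output_peelingScheme_eq_trunc (Q ω)
        (fun r => 2 * (m / 2 ^ r)) trunc A R 0 Finset.univ 0
      simp only [scheme, hY]
      exact hts Y
    · have h1 := measurements_peelingScheme_le (Q ω) (fun r => 2 * (m / 2 ^ r)) trunc A
        (fun r => if r = 0 then m else 2 * (m / 2 ^ (r - 1))) (fun r => by simp) R 0 Finset.univ 0
        (by simp)
      refine le_trans ?_ (sum_measurements_le m k d s R)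
      simp only [zero_add] at h1
      exact_mod_cast h1

theorem theorem3 :
    ∃ C : ℝ, 1 < C ∧ ∃ R : ℝ, 0 < R ∧
      ∀ c : ℝ, 0 < c → ∃ K : ℝ, 0 < K ∧
        ∀ n m k : ℕ, 1 ≤ m → 1 ≤ k → k ≤ n →
          ∃ P : RandomizedScheme n m, ∀ A : Matrix (Fin n) (Fin m) ℝ,
            -- with high probability, the output is within the factor `C` of the optimum
            1 - (n : ℝ) ^ (-c) ≤
              P.law.real {ω | matrixL1 (A - (P.scheme ω).output A) ≤ C * sparseOpt (k * m) A} ∧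
            -- whatever the random choices are: sparse output, few measurements, few rounds
            ∀ ω : P.Seed,
              IsSparseMatrix (k * m) ((P.scheme ω).output A) ∧
              ((P.scheme ω).measurements A : ℝ) ≤
                K * (k * m * Real.log (2 * n) * Real.log (2 * m)) ∧
              ((P.scheme ω).rounds A : ℝ) ≤ R * Real.log (2 * m) := by
  have hl2 : 0 < Real.log 2 := Real.log_pos (by norm_num)
  refine ⟨22415, by norm_num, 2 / Real.log 2, by positivity, fun c hc => ?_⟩
  obtain ⟨K, hK, hrep⟩ := exists_repetitions c hc
  refine ⟨32768 * (2 / Real.log 2 / Real.log 2) + 32 * K, by positivity, ?_⟩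
  intro n m k hm hk hkn
  have hn : 1 ≤ n := hk.trans hkn
  have hn' : (1 : ℝ) ≤ n := by exact_mod_cast hn
  have hm' : (1 : ℝ) ≤ m := by exact_mod_cast hm
  have hk' : (1 : ℝ) ≤ k := by exact_mod_cast hk
  obtain ⟨s, hs, hfail, hsK⟩ := hrep n m hn hm
  obtain ⟨d, hd⟩ : ∃ d, d = Nat.log 2 n + 1 := ⟨_, rfl⟩
  obtain ⟨R, hR⟩ : ∃ R, R = Nat.log 2 m + 2 := ⟨_, rfl⟩
  have hd4 : 2 * n ≤ 4 ^ d := by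
    have h1 : n < 2 ^ d := hd ▸ Nat.lt_pow_succ_log_self (by norm_num) n
    have h2 : 2 ≤ 2 ^ d := by
      rw [hd, pow_succ]
      have : 1 ≤ 2 ^ Nat.log 2 n := Nat.one_le_two_pow
      omega
    calc 2 * n ≤ 2 ^ d * 2 ^ d := Nat.mul_le_mul h2 h1.le
      _ = 4 ^ d := by rw [← mul_pow]; norm_num
  have hmR : m < 2 ^ (R - 1) := hR ▸ Nat.lt_pow_succ_log_self (by norm_num) m
  have hlogd : (d : ℝ) ≤ Real.log (2 * n) / Real.log 2 := by
    have h := Real.natLog_le_logb n 2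
    rw [Real.logb] at h
    rw [Real.log_mul (by norm_num) (by positivity), add_div, div_self hl2.ne', hd]
    push_cast at h ⊢
    linarith
  have hlogR : (R : ℝ) ≤ 2 / Real.log 2 * Real.log (2 * m) := by
    have h := Real.natLog_le_logb m 2
    rw [Real.logb] at h
    rw [Real.log_mul (by norm_num) (by positivity), mul_add, div_mul_cancel₀ _ hl2.ne', hR]
    have h0 : 0 ≤ Real.log m / Real.log 2 := div_nonneg (Real.log_nonneg hm') hl2.le
    push_cast at h ⊢
    have : 2 / Real.log 2 * Real.log m = 2 * (Real.log m / Real.log 2) := by ring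
    linarith
  have hR2m : R ≤ 2 * m := by
    have : Nat.log 2 m < m := Nat.log_lt_self 2 (by omega)
    omega
  obtain ⟨P, hP⟩ := exists_randomizedScheme hk hkn (by omega) hd4 hs (by omega) hmR
  refine ⟨P, fun A => ⟨le_trans ?_ (hP A).1, fun ω => ?_⟩⟩
  · have hRm : ((R * m : ℕ) : ℝ) ≤ 2 * m * m := by exact_mod_cast Nat.mul_le_mul_right m hR2m
    have h34 : (0 : ℝ) ≤ 2 * (3 / 4) ^ s := by positivity
    nlinarith [mul_le_mul_of_nonneg_right hRm h34]
  · obtain ⟨h1, h2, h3⟩ := (hP A).2 ω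
    refine ⟨h1, h2.trans ?_, by rwa [h3]⟩
    have hx : 0 ≤ Real.log (2 * n) := Real.log_nonneg (by linarith)
    have hy : 0 ≤ Real.log (2 * m) := Real.log_nonneg (by linarith)
    calc (32768 * (k * m * d * R) + 32 * (m * s) : ℝ)
        ≤ 32768 * (k * m * (Real.log (2 * n) / Real.log 2) * (2 / Real.log 2 * Real.log (2 * m)))
          + 32 * ((k * m) * (K * (Real.log (2 * n) * Real.log (2 * m)))) := by
          gcongr
          nlinarith
      _ = _ := by ring
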